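/- Let $K$ be an algebraically closed field, $\Gamma$ a finite quiver and $I$ a two-sided ideal of the path algebra $K\Gamma$ (a product $qp$ means $q$ after $p$) such that $R^N\subseteq I\subseteq R$ for some $N$, where $R$ is the ideal spanned by the paths of positive length (for instance, $I$ admissible). Put $\Lambda=K\Gamma/I$, a finite dimensional algebra with Jacobson radical $J$; modules are left modules. Let $\mathbb S=(S(0),\dots,S(l))$ be a sequence of simple modules $S(i)=\Lambda e(i)/Je(i)$ with vertices $e(0),\dots,e(l)$, put $e=e(0)$, and let $p=\gamma_l\cdots\gamma_1\notin I$, with arrows $\gamma_i:e(i-1)\to e(i)$, be a path of length $l$ through $\mathbb S$. Let $p_i=\gamma_i\cdots\gamma_1$ be its right subpath of length $i$, $A_p$ the $K$-subspace of $\Lambda e$ spanned by $p_0,\dots,p_l$, and $m=\dim_K\Lambda e-\dim_K A_p$. Let $\mathcal G_m(\Lambda e)$ be the Grassmannian of $m$-dimensional subspaces of $\Lambda e$, with its structure of a projective variety given by the Plücker embedding, $\mathcal G_m^\Lambda(\Lambda e)$ the subset of those that are $\Lambda$-submodules, and $\mathcal G\text{-Uni}(p)$ the set of all $C\in\mathcal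 G_m^\Lambda(\Lambda e)$ with $\Lambda e=A_p\oplus C$. A detour on $p$ is a pair $(\alpha,p_r)$, where $0\le r\le l$ and $\alpha$ is an arrow starting in $e(r)$, such that $\alpha p_r\notin I$, $\alpha p_r\neq p_{r+1}$ as a path (if $r<l$), and the set $I(\alpha,p_r)$ of all $s$ with $r<s\le l$ for which $\alpha$ ends in $e(s)$ is non-empty. Let $V_p$ be the set of all families $k=(k_i(\alpha,u))$ of scalars, indexed by the detours $(\alpha,u)$ on $p$ and $i\in I(\alpha,u)$, for which there is a uniserial module $U=\Lambda x$ with $x=ex$, with sequence of consecutive composition factors $\mathbb S$ (from the top down) and with $pU\ne0$, such that $\alpha u x=\sum_{i\in I(\alpha,u)}k_i(\alpha,u)\,p_ix$ for all detours $(\alpha,u)$ on $p$. A path $q$ starting in $e$ is a route on $p$ if the sequence of vertices it passes through is a subsequence of $(e(0),\dots,e(l))$. For $k\in V_p$ put $$\psi_p(k)=\sum_{(\alpha,u)\text{ detour on }p}\Lambda\Bigl(\alpha u-\sum_{i\in I(\alpha,u)}k_i(\alpha,u)p_i\Bigr)+\sum_{q\text{ not a route on }p}\Lambda q\ \subseteq\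 \Lambda e .$$ Then $\mathcal G_m^\Lambda(\Lambda e)$ is closed in $\mathcal G_m(\Lambda e)$, and $\mathcal G\text{-Uni}(p)$ is an open affine subvariety of $\mathcal G_m^\Lambda(\Lambda e)$; in fact, $\mathcal G\text{-Uni}(p)$ is the intersection of $\mathcal G_m^\Lambda(\Lambda e)$ with a principal affine open subvariety of $\mathcal G_m(\Lambda e)$, that is, an affine subvariety which is the set of non-zeros of a homogeneous polynomial of positive degree in the Plücker coordinates. Moreover, $V_p$ is Zariski closed in affine space, and $\psi_p$ is an isomorphism of varieties $V_p\to\mathcal G\text{-Uni}(p)$. (Varieties may be reducible or empty.) -/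

import Mathlib

universe u v w

open Quiver

open scoped Topology

noncomputable section

/-! ### The path algebra of a finite quiver -/

/-- All paths of a quiver, bundled with their start and end vertices. -/
abbrev PathIdx (V : Type v) [Quiver.{w} V] := Σ a : V, Σ b : V, Path a b

/-- A path, bundled. -/
abbrev PathIdx.of {V : Type v} [Quiver.{w} V] {a b : V} (q : Path a b) : PathIdx V := ⟨a, b, q⟩

/-- The path algebra `KΓ`: the `K`-vector space with basis the paths of `Γ`. -/
def PathAlgebra (K : Type u) (V : Type v) [Field K] [Quiver.{w} V] := PathIdx V →₀ K

namespace PathAlgebra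

variable {K : Type u} {V : Type v} [Field K] [Quiver.{w} V]

instance : AddCommGroup (PathAlgebra K V) := inferInstanceAs (AddCommGroup (PathIdx V →₀ K))
instance : Module K (PathAlgebra K V) := inferInstanceAs (Module K (PathIdx V →₀ K))

/-- The basis element of `KΓ` given by a path. -/
def single (q : PathIdx V) : PathAlgebra K V := Finsupp.single q (1 : K)

open Classical in
/-- Product of two paths: `mulPaths q p` is `q p`, that is, `q` after `p`, if `p` ends where `q`
starts, and it is zero otherwise. -/
def mulPaths (q p : PathIdx V) : PathIdx V →₀ K :=
  if h : q.1 = p.2.1 then Finsupp.single ⟨p.1, q.2.1, p.2.2.comp (q.2.2.cast h rfl)⟩ 1 else 0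

/-- The bilinear extension of the product of paths. -/
def mulLin : (PathIdx V →₀ K) →ₗ[K] (PathIdx V →₀ K) →ₗ[K] (PathIdx V →₀ K) :=
  Finsupp.lift ((PathIdx V →₀ K) →ₗ[K] (PathIdx V →₀ K)) K (PathIdx V) fun q =>
    Finsupp.lift (PathIdx V →₀ K) K (PathIdx V) fun p => mulPaths q p

instance : Mul (PathAlgebra K V) := ⟨fun x y => mulLin (V := V) (K := K) x y⟩

/-- The unit is the sum of the trivial paths. -/
instance [Fintype V] : One (PathAlgebra K V) := ⟨∑ a : V, single (.of (Path.nil : Path a a))⟩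

theorem one_eq [Fintype V] :
    (1 : PathAlgebra K V) = ∑ a : V, single (.of (Path.nil : Path a a)) := rfl

theorem single_mul_single (q p : PathIdx V) :
    (single q * single p : PathAlgebra K V) = mulPaths (K := K) q p := by
  change mulLin (Finsupp.single q (1 : K)) (Finsupp.single p (1 : K)) = _
  simp [mulLin]

theorem single_mul_comp {a b c : V} (q : Path b c) (p : Path a b) :
    (single (.of q) * single (.of p) : PathAlgebra K V) = single (.of (p.comp q)) := by
  rw [single_mul_single]
  simp [mulPaths, single]
  rfl

theorem single_mul_ne {q p : PathIdx V} (h : q.1 ≠ p.2.1) :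
    (single q * single p : PathAlgebra K V) = 0 := by
  rw [single_mul_single]
  simp [mulPaths, h]
  rfl

theorem induction_on {P : PathAlgebra K V → Prop} (x : PathAlgebra K V) (h0 : P 0)
    (hadd : ∀ x y, P x → P y → P (x + y)) (hs : ∀ (c : K) q, P (c • single q)) : P x := by
  refine Finsupp.induction_linear (motive := P) x h0 hadd fun q c => ?_
  have h : (c • single q : PathAlgebra K V) = Finsupp.single q c := by
    change c • Finsupp.single q (1 : K) = _
    simp
  rw [← h]
  exact hs c q

protected theorem smul_mul (c : K) (x y : PathAlgebra K V) : (c • x) * y = c • (x * y) :=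
  LinearMap.map_smul₂ mulLin c x y

protected theorem mul_smul (c : K) (x y : PathAlgebra K V) : x * (c • y) = c • (x * y) :=
  (mulLin x).map_smul c y

protected theorem add_mul (x y z : PathAlgebra K V) : (x + y) * z = x * z + y * z :=
  LinearMap.map_add₂ mulLin x y z

protected theorem mul_add (x y z : PathAlgebra K V) : x * (y + z) = x * y + x * z :=
  (mulLin x).map_add y z

protected theorem zero_mul (x : PathAlgebra K V) : 0 * x = 0 := LinearMap.map_zero₂ mulLin x

protected theorem mul_zero (x : PathAlgebra K V) : x * 0 = 0 := (mulLin x).map_zero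

theorem single_assoc (r q p : PathIdx V) :
    (single r * single q * single p : PathAlgebra K V) = single r * (single q * single p) := by
  obtain ⟨r1, r2, r⟩ := r
  obtain ⟨q1, q2, q⟩ := q
  obtain ⟨p1, p2, p⟩ := p
  by_cases h1 : r1 = q2
  · subst h1
    by_cases h2 : q1 = p2
    · subst h2
      change single (.of r) * single (.of q) * single (.of p)
        = single (.of r) * (single (.of q) * single (.of p))
      simp only [single_mul_comp, Path.comp_assoc]
    · have e1 : (single ⟨q1, r1, q⟩ * single ⟨p1, p2, p⟩ : PathAlgebra K V) = 0 :=
        single_mul_ne h2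
      have e2 : (single (.of (q.comp r)) * single ⟨p1, p2, p⟩ : PathAlgebra K V) = 0 :=
        single_mul_ne h2
      rw [e1, PathAlgebra.mul_zero, ← e2, ← single_mul_comp]
  · have e1 : (single ⟨r1, r2, r⟩ * single ⟨q1, q2, q⟩ : PathAlgebra K V) = 0 :=
      single_mul_ne h1
    rw [e1, PathAlgebra.zero_mul]
    by_cases h2 : q1 = p2
    · subst h2
      have e2 : (single ⟨r1, r2, r⟩ * single (.of (p.comp q)) : PathAlgebra K V) = 0 :=
        single_mul_ne h1
      rw [← e2, ← single_mul_comp]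
    · have e2 : (single ⟨q1, q2, q⟩ * single ⟨p1, p2, p⟩ : PathAlgebra K V) = 0 :=
        single_mul_ne h2
      rw [e2, PathAlgebra.mul_zero]

protected theorem mul_assoc (x y z : PathAlgebra K V) : x * y * z = x * (y * z) := by
  refine induction_on (P := fun x => x * y * z = x * (y * z)) x ?_ ?_ fun a r => ?_
  · simp only [PathAlgebra.zero_mul]
  · intro x1 x2 h1 h2
    simp only [PathAlgebra.add_mul, h1, h2]
  refine induction_on (P := fun y => (a • single r) * y * z = (a • single r) * (y * z)) y ?_ ?_ fun b q => ?_
  · simp only [PathAlgebra.zero_mul, PathAlgebra.mul_zero]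
  · intro x1 x2 h1 h2
    simp only [PathAlgebra.add_mul, PathAlgebra.mul_add, h1, h2]
  refine induction_on 
    (P := fun z => (a • single r) * (b • single q) * z = (a • single r) * ((b • single q) * z)) z ?_ ?_ fun c p => ?_
  · simp only [PathAlgebra.mul_zero]
  · intro x1 x2 h1 h2
    simp only [PathAlgebra.mul_add, h1, h2]
  simp only [PathAlgebra.smul_mul, PathAlgebra.mul_smul, single_assoc]

variable [Fintype V]

theorem one_mul_single (p : PathIdx V) : (1 * single p : PathAlgebra K V) = single p := by
  obtain ⟨a, b, p⟩ := p
  have h : (1 * single ⟨a, b, p⟩ : PathAlgebra K V)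
      = ∑ c : V, single (.of (Path.nil : Path c c)) * single ⟨a, b, p⟩ := by
    exact (LinearMap.congr_fun (map_sum mulLin _ _) _).trans (LinearMap.sum_apply _ _ _)
  rw [h, Finset.sum_eq_single b]
  · exact single_mul_comp _ _
  · intro c _ hc
    exact single_mul_ne hc
  · simp

theorem single_mul_one (p : PathIdx V) : (single p * 1 : PathAlgebra K V) = single p := by
  obtain ⟨a, b, p⟩ := p
  have h : (single ⟨a, b, p⟩ * 1 : PathAlgebra K V)
      = ∑ c : V, single ⟨a, b, p⟩ * single (.of (Path.nil : Path c c)) := by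
    exact map_sum (mulLin (Finsupp.single _ (1 : K))) _ _
  rw [h, Finset.sum_eq_single a]
  · refine (single_mul_comp _ _).trans ?_
    rw [Path.nil_comp]
  · intro c _ hc
    exact single_mul_ne hc.symm
  · simp

instance : Ring (PathAlgebra K V) :=
  { (inferInstance : AddCommGroup (PathAlgebra K V)) with
    mul := (· * ·)
    one := 1
    left_distrib := PathAlgebra.mul_add
    right_distrib := PathAlgebra.add_mul
    zero_mul := PathAlgebra.zero_mul
    mul_zero := PathAlgebra.mul_zero
    mul_assoc := PathAlgebra.mul_assoc
    one_mul := fun x => by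
      refine induction_on (P := fun x => 1 * x = x) x (PathAlgebra.mul_zero _) ?_ fun c p => ?_
      · intro y z hy hz
        rw [PathAlgebra.mul_add, hy, hz]
      · rw [PathAlgebra.mul_smul, one_mul_single]
    mul_one := fun x => by
      refine induction_on (P := fun x => x * 1 = x) x (PathAlgebra.zero_mul _) ?_ fun c p => ?_
      · intro y z hy hz
        rw [PathAlgebra.add_mul, hy, hz]
      · rw [PathAlgebra.smul_mul, single_mul_one] }

instance : Algebra K (PathAlgebra K V) :=
  Algebra.ofModule PathAlgebra.smul_mul PathAlgebra.mul_smul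

end PathAlgebra

/-! ### Bound quiver algebras, masts and detours -/

namespace BoundQuiver

variable {K : Type u} [Field K] {V : Type v} [Quiver.{w} V] [Fintype V]

/-- With `R` the ideal of `KΓ` spanned by the paths of positive length, `I ⊆ R` and `R ^ N ⊆ I` for
some `N`. (The usual admissible ideals are those which even satisfy `I ⊆ R ^ 2`.) -/
structure IsRelationIdeal (I : Ideal (PathAlgebra K V)) : Prop where
  /-- no trivial path occurs in an element of `I` -/
  le_arrows : ∀ x ∈ I, ∀ a : V, (show PathIdx V →₀ K from x) (.of (Path.nil : Path a a)) = 0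
  /-- all sufficiently long paths lie in `I` -/
  arrows_pow_le : ∃ N : ℕ, ∀ (a b : V) (q : Path a b), N ≤ q.length →
    (PathAlgebra.single (.of q) : PathAlgebra K V) ∈ I

variable (I : Ideal (PathAlgebra K V)) [I.IsTwoSided]

/-- The algebra `Λ = KΓ / I`. -/
abbrev Alg := PathAlgebra K V ⧸ I

/-- The canonical image in `Λ` of a path. -/
def cls {a b : V} (q : Path a b) : Alg I :=
  Ideal.Quotient.mk I (PathAlgebra.single (.of q))

/-- The left ideal `Λ e` belonging to a vertex `e`. -/
abbrev Proj (a : V) : Submodule (Alg I) (Alg I) :=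
  Submodule.span (Alg I) {cls I (Path.nil : Path a a)}

/-- The idempotent `e`, as an element of `Λ e`. -/
def top (a : V) : Proj I a := ⟨cls I (Path.nil : Path a a), Submodule.subset_span rfl⟩

/-- A path starting in `e`, as an element `q = q e` of `Λ e`. -/
def elt {a b : V} (q : Path a b) : Proj I a := cls I q • top I a

/-- The submodule `J e` of `Λ e`, where `J` is the Jacobson radical of `Λ`. -/
def radProj (a : V) : Submodule (Alg I) (Proj I a) :=
  Submodule.map (LinearMap.toSpanSingleton (Alg I) (Proj I a) (top I a))
    (Ring.jacobson (Alg I))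

/-- The simple module `Λ e / J e`. -/
abbrev Simple (a : V) := Proj I a ⧸ radProj I a

/-- `U` is uniserial (its submodules form a chain) with sequence of consecutive composition factors
`(S(e 0), …, S(e l))`, from the top down to the socle. -/
def IsUniserialWith {l : ℕ} (e : Fin (l + 1) → V) (U : Type*) [AddCommGroup U] [Module (Alg I) U] :
    Prop :=
  IsChain (· ≤ ·) (Set.univ : Set (Submodule (Alg I) U)) ∧
  ∃ M : Fin (l + 2) → Submodule (Alg I) U, M 0 = ⊤ ∧ M (Fin.last (l + 1)) = ⊥ ∧
    ∀ i : Fin (l + 1), M i.succ ≤ M i.castSucc ∧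
      Nonempty ((M i.castSucc ⧸ (M i.succ).submoduleOf (M i.castSucc)) ≃ₗ[Alg I] Simple I (e i))

section Path

variable {l : ℕ} {e : Fin (l + 1) → V} (γ : ∀ i : Fin l, e i.castSucc ⟶ e i.succ)

/-- The right subpath `p_i = γ_i ⋯ γ_1` of length `i` of the path `p = γ_l ⋯ γ_1` passing through
the vertices `e 0, …, e l`; the arrow `γ_(i+1) : e i ⟶ e (i+1)` is written `γ i`. -/
def sub (i : Fin (l + 1)) : Path (e 0) (e i) :=
  Fin.induction (motive := fun i => Path (e 0) (e i)) Path.nil (fun i q => q.cons (γ i)) i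

/-- The path `p` itself. -/
abbrev full : Path (e 0) (e (Fin.last l)) := sub γ (Fin.last l)

/-- The subspace `A_p` of `Λ e(0)` spanned by `p_0, …, p_l`. -/
def spanA : Submodule K (Proj I (e 0)) :=
  Submodule.span K (Set.range fun i : Fin (l + 1) => elt I (sub γ i))

/-- The detours `(α, p_m)` on `p`: `α p_m` is a path which does not lie in `I` and is different from
`p_(m+1)`, and `α` ends in the end vertex of `p_s` for some `s > m`. -/
structure Detour where
  /-- the length of the right subpath `p_m` -/
  m : Fin (l + 1)
  /-- the end vertex of the arrow -/
  b : V
  /-- the arrow -/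
  α : e m ⟶ b
  not_mem : (PathAlgebra.single (.of ((sub γ m).cons α)) : PathAlgebra K V) ∉ I
  ne_sub : ∀ i : Fin l, i.castSucc = m → PathIdx.of ((sub γ m).cons α) ≠ PathIdx.of (sub γ i.succ)
  exists_index : ∃ s : Fin (l + 1), m < s ∧ e s = b

variable {I γ}

/-- The path `α p_m` of a detour `(α, p_m)`. -/
def Detour.path (d : Detour I γ) : Path (e 0) d.b := (sub γ d.m).cons d.α

/-- The index set `I(α, p_m)` of a detour. -/
abbrev Detour.Idx (d : Detour I γ) := {s : Fin (l + 1) // d.m < s ∧ e s = d.b}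

instance (d : Detour I γ) : Fintype d.Idx := Fintype.ofFinite _

variable (I γ)

/-- The index set of the coordinates `k_i(α, p_m)`. -/
abbrev Coord := Σ d : Detour I γ, d.Idx

/-- The uniserial variety `V_p`: the set of all coordinate tuples `k` such that, for some uniserial
module `U = Λ x`, `x = e(0) x`, with composition factors `(S(e 0), …, S(e l))` and mast `p`
(meaning `p U ≠ 0`), the equation `α p_m x = ∑ k_i(α, p_m) p_i x` holds for all detours. -/
def uniVar : Set (Coord I γ → K) :=
  {k | ∃ (U : Type max u v w) (_ : AddCommGroup U) (_ : Module (Alg I) U) (x : U),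
    IsUniserialWith I e U ∧ (∃ y : U, cls I (full γ) • y ≠ 0) ∧
    Submodule.span (Alg I) {x} = ⊤ ∧ cls I (Path.nil : Path (e 0) (e 0)) • x = x ∧
    ∀ d : Detour I γ, cls I d.path • x = (∑ i : d.Idx, k ⟨d, i⟩ • cls I (sub γ i.1)) • x}

variable (e) in
/-- `q` is a route on `p`: its sequence of vertices is a subsequence of `(e 0, …, e l)`. -/
def IsRoute {b : V} (q : Path (e 0) b) : Prop := q.vertices.Sublist (List.ofFn e)

/-- The submodule `ψ_p(k)` of `Λ e(0)` generated by the elements `α u - ∑ k_i(α, u) p_i`, where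
`(α, u)` is a detour on `p`, and by the paths starting in `e(0)` which are not routes on `p`. -/
def psi (k : Coord I γ → K) : Submodule (Alg I) (Proj I (e 0)) :=
  Submodule.span (Alg I)
    ({z | ∃ d : Detour I γ, z = elt I d.path - ∑ i : d.Idx, k ⟨d, i⟩ • elt I (sub γ i.1)} ∪
      {z | ∃ (b : V) (q : Path (e 0) b), ¬ IsRoute e q ∧ z = elt I q})

end Path

end BoundQuiver

/-! ### Varieties as spaces with functions -/

namespace Var

/-- A topology on `X` and, for open subsets `U`, a notion of regular functions on `U`; a function on
`U` is given by any extension to a function on `X`. -/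
structure FunSpace (K : Type u) (X : Type v) where
  /-- the topology -/
  topology : TopologicalSpace X
  /-- `IsRegular U f`: the restriction of `f` to the open set `U` is regular -/
  IsRegular : Set X → (X → K) → Prop

section

variable {K : Type u} {X : Type v} {Y : Type w}

/-- Morphisms: continuous maps that pull back regular functions to regular functions. -/
def IsMorphism (S : FunSpace K X) (T : FunSpace K Y) (φ : X → Y) : Prop :=
  Continuous[S.topology, T.topology] φ ∧
  ∀ U : Set Y, IsOpen[T.topology] U → ∀ f : Y → K, T.IsRegular U f → S.IsRegular (φ ⁻¹' U) (f ∘ φ)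

/-- Isomorphisms: bijections that are morphisms in both directions. -/
def IsIso (S : FunSpace K X) (T : FunSpace K Y) (φ : X ≃ Y) : Prop :=
  IsMorphism S T φ ∧ IsMorphism T S φ.symm

/-- The structure induced on `Y` by an injective map `j : Y → X`: the induced topology, and the
functions that are locally pulled back from regular functions on open subsets of `X`. -/
def induced (S : FunSpace K X) (j : Y → X) : FunSpace K Y where
  topology := S.topology.induced j
  IsRegular W f := ∀ y ∈ W, ∃ (U : Set X) (g : X → K), IsOpen[S.topology] U ∧ S.IsRegular U g ∧
    j y ∈ U ∧ ∀ z ∈ W, j z ∈ U → f z = g (j z)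

/-- The structure of a (locally closed) subset. -/
abbrev restrict (S : FunSpace K X) (Z : Set X) : FunSpace K Z := induced S Subtype.val

end

/-- Affine space with coordinates indexed by `ι`: the Zariski topology, with the nonvanishing sets of
polynomials as a basis; regular functions are those that are locally quotients of polynomials. -/
def affineSpace (K : Type u) [Field K] (ι : Type v) : FunSpace K (ι → K) where
  topology := TopologicalSpace.generateFrom
    {U | ∃ P : MvPolynomial ι K, U = {x | MvPolynomial.eval x P ≠ 0}}
  IsRegular U f := ∀ x ∈ U, ∃ P Q : MvPolynomial ι K, MvPolynomial.eval x Q ≠ 0 ∧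
    ∀ y ∈ U, MvPolynomial.eval y Q ≠ 0 → f y = MvPolynomial.eval y P / MvPolynomial.eval y Q

/-- Affine varieties: the spaces isomorphic to a Zariski closed subset of some `K ^ n`. -/
def IsAffine {K : Type u} [Field K] {X : Type v} (S : FunSpace K X) : Prop :=
  ∃ (n : ℕ) (Z : Set (Fin n → K)) (φ : X ≃ Z),
    IsClosed[(affineSpace K (Fin n)).topology] Z ∧ IsIso S (restrict (affineSpace K (Fin n)) Z) φ

section Projective

variable (K : Type u) [Field K] (W : Type v) [AddCommGroup W] [Module K W]

/-- Polynomials on the vector space `W`, written as polynomials in the linear forms on `W`. -/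
abbrev Poly := MvPolynomial (Module.Dual K W) K

variable {K W}

/-- The value at `x : W` of a polynomial on `W`. -/
def evalAt (x : W) (F : Poly K W) : K := MvPolynomial.eval (fun φ : Module.Dual K W => φ x) F

variable (K W)

open scoped LinearAlgebra.Projectivization in
/-- The projective space `ℙ(W)`: the Zariski topology, with the nonvanishing sets of homogeneous
polynomials as a basis; regular functions are those that are locally quotients of homogeneous
polynomials of the same degree. -/
def projectiveSpace : FunSpace K (ℙ K W) where
  topology := TopologicalSpace.generateFrom
    {U | ∃ (d : ℕ) (F : Poly K W), F.IsHomogeneous d ∧ U = {x | evalAt x.rep F ≠ 0}}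
  IsRegular U f := ∀ x ∈ U, ∃ (d : ℕ) (F G : Poly K W), F.IsHomogeneous d ∧ G.IsHomogeneous d ∧
    evalAt x.rep G ≠ 0 ∧ ∀ y ∈ U, evalAt y.rep G ≠ 0 → f y = evalAt y.rep F / evalAt y.rep G

end Projective

section Grassmannian

variable (K : Type u) [Field K] (M : Type v) [AddCommGroup M] [Module K M] (m : ℕ)

/-- The set of all `m`-dimensional subspaces of `M`. -/
def Gr := {C : Submodule K M // FiniteDimensional K C ∧ Module.finrank K C = m}

variable {K M m}

/-- The vector `c_1 ∧ ⋯ ∧ c_m` of `⋀^m M` for a basis `c_1, …, c_m` of the subspace `C`. -/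
def pluckerVector (C : Gr K M m) : ⋀[K]^m M :=
  haveI := C.2.1
  exteriorPower.ιMulti K m fun i => (Module.finBasisOfFinrankEq K C.1 C.2.2 i : M)

theorem pluckerVector_ne_zero (C : Gr K M m) : pluckerVector C ≠ 0 := by
  have := C.2.1
  have hli : LinearIndependent K fun i => (Module.finBasisOfFinrankEq K C.1 C.2.2 i : M) :=
    (Module.finBasisOfFinrankEq K C.1 C.2.2).linearIndependent.map' C.1.subtype
      (Submodule.ker_subtype _)
  have h := exteriorPower.ιMulti_family_linearIndependent_field (n := m) hli
  let s : Set.powersetCard (Fin m) m := ⟨Finset.univ, by simp⟩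
  have h1 := h.ne_zero s
  have h2 : (Set.powersetCard.ofFinEmbEquiv.symm s : Fin m → Fin m) = id := by
    set f := Set.powersetCard.ofFinEmbEquiv.symm s
    refine (StrictMono.range_inj f.strictMono strictMono_id).1 ?_
    rw [Set.range_id, Set.range_eq_univ]
    exact Finite.surjective_of_injective f.injective
  rwa [exteriorPower.ιMulti_family, h2, Function.comp_id] at h1

open scoped LinearAlgebra.Projectivization in
/-- The Plücker map `C ↦ ⋀^m C`; the point does not depend on the choice of a basis of `C`. -/
def plucker (C : Gr K M m) : ℙ K (⋀[K]^m M) :=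
  Projectivization.mk K (pluckerVector C) (pluckerVector_ne_zero C)

variable (K M m)

/-- The Grassmannian `G_m(M)` as a variety, through the Plücker embedding. -/
def grassmannian : FunSpace K (Gr K M m) := induced (projectiveSpace K (⋀[K]^m M)) plucker

variable {K M m}

/-- The principal affine open subvarieties of `G_m(M)`: affine subsets that are the nonvanishing set
of a homogeneous polynomial of positive degree in the Plücker coordinates. -/
def IsPrincipalAffine (D : Set (Gr K M m)) : Prop :=
  (∃ (d : ℕ) (F : Poly K (⋀[K]^m M)), 0 < d ∧ F.IsHomogeneous d ∧
    D = {C | evalAt (pluckerVector C) F ≠ 0}) ∧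
  IsAffine (restrict (grassmannian K M m) D)

end Grassmannian

end Var

namespace BoundQuiver

open Var

variable {K : Type u} [Field K] {V : Type v} [Quiver.{w} V] [Fintype V]
  (I : Ideal (PathAlgebra K V)) [I.IsTwoSided] {l : ℕ} {e : Fin (l + 1) → V}
  (γ : ∀ i : Fin l, e i.castSucc ⟶ e i.succ)

/-- The number `m = dim Λ e(0) - dim A_p`. -/
def codim : ℕ := Module.finrank K (Proj I (e 0)) - Module.finrank K (spanA I γ)

/-- The Grassmannian `G_m(Λ e(0))`. -/
abbrev GrP := Gr K (Proj I (e 0)) (codim I γ)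

/-- The variety structure on `G_m(Λ e(0))`. -/
abbrev grP : FunSpace K (GrP I γ) := grassmannian K (Proj I (e 0)) (codim I γ)

/-- The set `G_m^Λ(Λ e(0))` of all `m`-dimensional `Λ`-submodules of `Λ e(0)`. -/
def grLam : Set (GrP I γ) := {C | ∀ (a : Alg I), ∀ c ∈ C.1, a • c ∈ C.1}

/-- The set `G-Uni(p)` of all `m`-dimensional `Λ`-submodules of `Λ e(0)` that complement `A_p`. -/
def gUni : Set (GrP I γ) := {C | C ∈ grLam I γ ∧ IsCompl (spanA I γ) C.1}

end BoundQuiver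

end

/-!
Write `P = Λ e`, and let `p_0, …, p_l` be the right subpaths of `p`. The proof rests on three facts.

*Uniserial modules with mast `p` are the quotients of `P` by the submodules complementing `A_p`.* If
`U = Λ x` is uniserial with composition factors `S(e 0), …, S(e l)` and `p U ≠ 0`, then every arrow
moves a vector down by at least one layer of `U`. Hence the vectors `p_i x` are linearly independent,
a path which is not a route kills `x`, and so `ψ_p(k)` meets `A_p` trivially (`isCompl_psi`).
Conversely, if `C` complements `A_p`, then the images of the `p_i` form a basis of `P / C`, and since
the ideal generated by the arrows is nilpotent, they are adapted to a unique composition series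
(`coeff_eq_zero`, `isUniserialWith_of_mast`). The coefficients of the detours in `P / C` define
`k ∈ V_p` with `ψ_p(k) = C` (`exists_psi_eq`).

*For every family `k` of scalars, each element `z` of `P` is congruent modulo `ψ_p(k)` to a linear
combination of the `p_i` whose coefficients are polynomials in `k`* (`exists_poly`). This follows by
induction on paths, as an arrow times `p_i` is zero, the next subpath, a detour, or not a route.

*The complements of `A_p` in `P` form an affine chart of the Grassmannian.* After the choice of a
basis extending `p_0, …, p_l`, they are the graphs of matrices `f`. The Plücker coordinates of a graph
are polynomials in `f`, and `f` is recovered as a quotient of two linear forms in the Plücker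
coordinates (`chart`, `chartCoord`, `detForm`). In such charts, stability under an endomorphism is
a polynomial condition, so that the submodules form a closed set (`isClosed_stable`).

Consequently `ψ_p` is given in the chart by a polynomial map `η`, and its inverse by a polynomial map
`θ` in the chart coordinates, which expresses the detours in the chosen basis. Therefore `V_p` is the
set of all `k` such that `η(k)` is a submodule and `θ(η(k)) = k`, hence closed, and `ψ_p` is an
isomorphism onto the closed part of the chart formed by the submodules.
-/

/-! ### Paths in the quotient algebra -/

namespace BoundQuiver

section Paths

variable {K : Type u} [Field K] {V : Type v} [Quiver.{w} V] [Fintype V]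
  (I : Ideal (PathAlgebra K V)) [I.IsTwoSided]

theorem cls_comp {a b c : V} (q : Path a b) (r : Path b c) :
    cls I (q.comp r) = cls I r * cls I q := by
  rw [cls, ← PathAlgebra.single_mul_comp, map_mul]
  rfl

theorem cls_cons {a b c : V} (q : Path a b) (α : b ⟶ c) :
    cls I (q.cons α) = cls I α.toPath * cls I q :=
  cls_comp I q α.toPath

theorem cls_mul_eq_zero {a b c d : V} (r : Path c d) (q : Path a b) (h : c ≠ b) :
    cls I r * cls I q = 0 := by
  rw [cls, cls, ← map_mul, PathAlgebra.single_mul_ne (by exact h), map_zero]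

theorem cls_nil_mul {a b : V} (q : Path a b) : cls I (Path.nil : Path b b) * cls I q = cls I q :=
  (cls_comp I q Path.nil).symm

theorem cls_mul_nil {a b : V} (q : Path a b) : cls I q * cls I (Path.nil : Path a a) = cls I q := by
  rw [← cls_comp, Path.nil_comp]

theorem cls_eq_zero {a b : V} {q : Path a b} :
    cls I q = 0 ↔ (PathAlgebra.single (.of q) : PathAlgebra K V) ∈ I :=
  Ideal.Quotient.eq_zero_iff_mem

theorem cls_congr {a b a' b' : V} {q : Path a b} {q' : Path a' b'}
    (h : PathIdx.of q = PathIdx.of q') : cls I q = cls I q' := by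
  rw [cls, h, ← cls]

/-- The algebra `Λ` is spanned by the residue classes of paths. -/
theorem alg_induction {P : Alg I → Prop} (x : Alg I) (h0 : P 0)
    (hadd : ∀ x y, P x → P y → P (x + y))
    (hs : ∀ (c : K) (a b : V) (q : Path a b), P (c • cls I q)) : P x := by
  obtain ⟨y, rfl⟩ := Ideal.Quotient.mk_surjective x
  refine PathAlgebra.induction_on (P := fun y => P (Ideal.Quotient.mk I y)) y ?_ ?_ ?_
  · rw [map_zero]
    exact h0
  · intro y z hy hz
    rw [map_add]
    exact hadd _ _ hy hz
  · rintro c ⟨a, b, q⟩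
    exact hs c a b q

/-- The subspace of `Λ` spanned by the classes of the paths of length at least `n`; these are the
powers of the ideal generated by the arrows. -/
noncomputable def pathsGE (n : ℕ) : Submodule K (Alg I) :=
  Submodule.span K {x | ∃ (a b : V) (q : Path a b), n ≤ q.length ∧ x = cls I q}

theorem cls_mem_pathsGE {a b : V} (q : Path a b) {n : ℕ} (h : n ≤ q.length) :
    cls I q ∈ pathsGE I n :=
  Submodule.subset_span ⟨a, b, q, h, rfl⟩

theorem mem_pathsGE_zero (x : Alg I) : x ∈ pathsGE I 0 :=
  alg_induction I x (zero_mem _) (fun _ _ => add_mem)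
    fun c _ _ q => Submodule.smul_mem _ c (cls_mem_pathsGE I q (Nat.zero_le _))

theorem mul_mem_pathsGE {m n : ℕ} {x y : Alg I} (hx : x ∈ pathsGE I m) (hy : y ∈ pathsGE I n) :
    x * y ∈ pathsGE I (m + n) := by
  induction hx using Submodule.span_induction with
  | zero => rw [zero_mul]; exact zero_mem _
  | add x x' _ _ hx hx' => rw [add_mul]; exact add_mem hx hx'
  | smul c x _ hx => rw [smul_mul_assoc]; exact Submodule.smul_mem _ c hx
  | mem x hx =>
    obtain ⟨c, d, r, hr, rfl⟩ := hx
    induction hy using Submodule.span_induction with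
    | zero => rw [mul_zero]; exact zero_mem _
    | add x x' _ _ hx hx' => rw [mul_add]; exact add_mem hx hx'
    | smul c x _ hx => rw [mul_smul_comm]; exact Submodule.smul_mem _ c hx
    | mem y hy =>
      obtain ⟨a, b, q, hq, rfl⟩ := hy
      by_cases h : c = b
      · subst h
        rw [← cls_comp]
        exact cls_mem_pathsGE I _ (by rw [Path.length_comp]; omega)
      · rw [cls_mul_eq_zero I r q h]
        exact zero_mem _

theorem mul_mem_pathsGE_right (x : Alg I) {n : ℕ} {y : Alg I} (hy : y ∈ pathsGE I n) :
    x * y ∈ pathsGE I n := by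
  simpa using mul_mem_pathsGE I (mem_pathsGE_zero I x) hy

theorem mul_mem_pathsGE_left {n : ℕ} {x : Alg I} (hx : x ∈ pathsGE I n) (y : Alg I) :
    x * y ∈ pathsGE I n := by
  simpa using mul_mem_pathsGE I hx (mem_pathsGE_zero I y)

variable {I}

theorem isNilpotent_of_mem_pathsGE (hI : IsRelationIdeal I) {x : Alg I} (hx : x ∈ pathsGE I 1) :
    IsNilpotent x := by
  obtain ⟨N, hN⟩ := hI.arrows_pow_le
  have hpow : ∀ n : ℕ, x ^ n ∈ pathsGE I n := by
    intro n
    induction n with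
    | zero => exact mem_pathsGE_zero I _
    | succ n ih => rw [pow_succ]; exact mul_mem_pathsGE I ih hx
  have hbot : pathsGE I N = ⊥ := by
    rw [pathsGE, Submodule.span_eq_bot]
    rintro _ ⟨a, b, q, hq, rfl⟩
    exact (cls_eq_zero I).2 (hN a b q hq)
  exact ⟨N, by simpa [hbot] using hpow N⟩

theorem mem_jacobson_of_mem_pathsGE (hI : IsRelationIdeal I) {x : Alg I}
    (hx : x ∈ pathsGE I 1) : x ∈ Ring.jacobson (Alg I) := by
  rw [← Ideal.jacobson_bot, Ideal.mem_jacobson_iff]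
  intro y
  obtain ⟨u, hu⟩ :=
    (isNilpotent_of_mem_pathsGE hI (mul_mem_pathsGE_right I y hx)).isUnit_one_add
  refine ⟨(↑u⁻¹ : Alg I), ?_⟩
  have h : (↑u⁻¹ : Alg I) * (1 + y * x) = 1 := by rw [← hu, Units.inv_mul]
  rw [Submodule.mem_bot, sub_eq_zero, ← h]
  noncomm_ring

section Finite

variable [∀ a b : V, Finite (a ⟶ b)]

theorem finite_paths_of_length (V : Type v) [Quiver.{w} V] [Finite V]
    [∀ a b : V, Finite (a ⟶ b)] (n : ℕ) : {q : PathIdx V | q.2.2.length = n}.Finite := by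
  induction n with
  | zero =>
    refine (Set.finite_range fun a : V => PathIdx.of (Path.nil : Path a a)).subset ?_
    rintro ⟨a, b, q⟩ hq
    cases q with
    | nil => exact ⟨a, rfl⟩
    | cons q α => simp at hq
  | succ n ih =>
    have : Finite {q : PathIdx V | q.2.2.length = n} := ih
    refine (Set.finite_range fun x : Σ (q : {q : PathIdx V | q.2.2.length = n}) (c : V),
      (q.1.2.1 ⟶ c) => PathIdx.of (x.1.1.2.2.cons x.2.2)).subset ?_
    rintro ⟨a, b, q⟩ hq
    cases q with
    | nil => simp at hq
    | cons q α =>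
      simp only [Set.mem_ofPred_eq, Path.length_cons, Nat.add_right_cancel_iff] at hq
      exact ⟨⟨⟨⟨_, _, q⟩, hq⟩, _, α⟩, rfl⟩

theorem finite_alg (hI : IsRelationIdeal I) : Module.Finite K (Alg I) := by
  obtain ⟨N, hN⟩ := hI.arrows_pow_le
  have hfin : {q : PathIdx V | q.2.2.length < N}.Finite := by
    have : {q : PathIdx V | q.2.2.length < N}
        = ⋃ n ∈ Finset.range N, {q : PathIdx V | q.2.2.length = n} := by
      ext q
      simp
    rw [this]
    exact Set.Finite.biUnion (Finset.finite_toSet _) fun n _ => finite_paths_of_length V n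
  refine ⟨(Submodule.fg_def).2
    ⟨(fun q : PathIdx V => cls I q.2.2) '' {q | q.2.2.length < N}, hfin.image _, ?_⟩⟩
  refine eq_top_iff.2 fun x _ => ?_
  refine alg_induction I x (zero_mem _) (fun _ _ => add_mem) fun c a b q => ?_
  refine Submodule.smul_mem _ c ?_
  by_cases hq : q.length < N
  · exact Submodule.subset_span ⟨⟨a, b, q⟩, hq, rfl⟩
  · rw [(cls_eq_zero I).2 (hN a b q (not_lt.1 hq))]
    exact zero_mem _

theorem finite_proj (hI : IsRelationIdeal I) (a : V) : Module.Finite K (Proj I a) := by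
  have := finite_alg hI
  have : IsNoetherian K (Alg I) := isNoetherian_of_isNoetherianRing_of_finite K _
  exact Module.Finite.of_injective ((Proj I a).subtype.restrictScalars K) Subtype.val_injective

end Finite

variable (I)

theorem coe_top (a : V) : (top I a : Alg I) = cls I (Path.nil : Path a a) := rfl

theorem coe_elt {a b : V} (q : Path a b) : (elt I q : Alg I) = cls I q :=
  cls_mul_nil I q

theorem elt_nil (a : V) : elt I (Path.nil : Path a a) = top I a :=
  Subtype.ext (coe_elt I _)

theorem cls_smul_elt {a b c : V} (q : Path a b) (r : Path b c) :
    cls I r • elt I q = elt I (q.comp r) := by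
  rw [elt, elt, cls_comp, mul_smul]

theorem elt_congr {a b b' : V} {q : Path a b} {q' : Path a b'}
    (h : PathIdx.of q = PathIdx.of q') : elt I q = elt I q' := by
  rw [elt, cls_congr I h, ← elt]

/-- `Λ e` is spanned by the paths starting in `e`. -/
theorem proj_induction {a : V} {P : Proj I a → Prop} (x : Proj I a) (h0 : P 0)
    (hadd : ∀ x y, P x → P y → P (x + y))
    (hs : ∀ (c : K) (b : V) (q : Path a b), P (c • elt I q)) : P x := by
  obtain ⟨x, hx⟩ := x
  obtain ⟨y, rfl⟩ := Submodule.mem_span_singleton.1 hx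
  change P (y • top I a)
  clear hx
  refine alg_induction I (P := fun y => P (y • top I a)) y (by rwa [zero_smul]) ?_ ?_
  · intro x y hx hy
    rw [add_smul]
    exact hadd _ _ hx hy
  · intro c a' b q
    by_cases h : a' = a
    · subst h
      rw [smul_assoc]
      exact hs c b q
    · have : (c • cls I q) • top I a = 0 := by
        rw [smul_assoc]
        have : cls I q • top I a = 0 := Subtype.ext (cls_mul_eq_zero I q _ h)
        rw [this, smul_zero]
      rwa [this]

/-! ### The simple modules -/

variable {I}

theorem pathsGE_smul_top_mem_radProj (hI : IsRelationIdeal I) {a : V} {x : Alg I}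
    (hx : x ∈ pathsGE I 1) : x • top I a ∈ radProj I a :=
  ⟨x, mem_jacobson_of_mem_pathsGE hI hx, rfl⟩

theorem exists_eq_smul_top_add {a : V} (z : Proj I a) :
    ∃ (c : K) (r : Alg I), r ∈ pathsGE I 1 ∧ z = c • top I a + r • top I a := by
  refine proj_induction I (P := fun z => ∃ (c : K) (r : Alg I), r ∈ pathsGE I 1 ∧
    z = c • top I a + r • top I a) z ⟨0, 0, zero_mem _, by simp⟩ ?_ ?_
  · rintro _ _ ⟨c, r, hr, rfl⟩ ⟨c', r', hr', rfl⟩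
    exact ⟨c + c', r + r', add_mem hr hr', by rw [add_smul, add_smul]; abel⟩
  · intro c b q
    cases q with
    | nil => exact ⟨c, 0, zero_mem _, by rw [elt_nil, zero_smul, add_zero]⟩
    | cons q α =>
      refine ⟨0, c • cls I (q.cons α), Submodule.smul_mem _ c (cls_mem_pathsGE I _ ?_), ?_⟩
      · simp
      · rw [zero_smul, zero_add, smul_assoc, elt]

theorem pathsGE_smul_simple (hI : IsRelationIdeal I) {a : V} {x : Alg I} (hx : x ∈ pathsGE I 1)
    (s : Simple I a) : x • s = 0 := by
  obtain ⟨z, rfl⟩ := Submodule.Quotient.mk_surjective _ s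
  obtain ⟨c, r, hr, rfl⟩ := exists_eq_smul_top_add z
  rw [← Submodule.Quotient.mk_smul, Submodule.Quotient.mk_eq_zero, smul_add, ← mul_smul,
    smul_comm, ← smul_assoc]
  exact add_mem (pathsGE_smul_top_mem_radProj hI (Submodule.smul_mem _ c hx))
    (pathsGE_smul_top_mem_radProj hI (mul_mem_pathsGE_left I hx r))

theorem nil_smul_simple (hI : IsRelationIdeal I) {a b : V} (h : b ≠ a) (s : Simple I a) :
    cls I (Path.nil : Path b b) • s = 0 := by
  obtain ⟨z, rfl⟩ := Submodule.Quotient.mk_surjective _ s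
  obtain ⟨c, r, hr, rfl⟩ := exists_eq_smul_top_add z
  have h0 : cls I (Path.nil : Path b b) • top I a = 0 := Subtype.ext (cls_mul_eq_zero I _ _ h)
  rw [← Submodule.Quotient.mk_smul, Submodule.Quotient.mk_eq_zero, smul_add, ← mul_smul,
    smul_comm, h0, smul_zero, zero_add]
  exact pathsGE_smul_top_mem_radProj hI (mul_mem_pathsGE_right I _ hr)

/-- A one-dimensional module spanned by a vector `s = e s` which is killed by all paths of positive
length is isomorphic to `Λ e / J e`. -/
theorem nonempty_equiv_simple (hI : IsRelationIdeal I) {a : V} {S : Type*} [AddCommGroup S]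
    [Module (Alg I) S] [Module K S] [IsScalarTower K (Alg I) S] {s : S} (hs : s ≠ 0)
    (hspan : ∀ y : S, ∃ c : K, y = c • s) (hnil : cls I (Path.nil : Path a a) • s = s)
    (hrad : ∀ x ∈ pathsGE I 1, x • s = 0) : Nonempty (S ≃ₗ[Alg I] Simple I a) := by
  let f : Proj I a →ₗ[Alg I] S := (LinearMap.toSpanSingleton (Alg I) S s).domRestrict (Proj I a)
  have hf : ∀ z : Proj I a, f z = (z : Alg I) • s := fun z => rfl
  have hftop : f (top I a) = s := by rw [hf, coe_top, hnil]
  have hsurj : Function.Surjective f := by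
    intro y
    obtain ⟨c, rfl⟩ := hspan y
    refine ⟨c • top I a, ?_⟩
    rw [f.map_smul_of_tower, hftop]
  have hker : LinearMap.ker f = radProj I a := by
    ext z
    rw [LinearMap.mem_ker]
    constructor
    · intro hz
      obtain ⟨c, r, hr, rfl⟩ := exists_eq_smul_top_add z
      rw [map_add, f.map_smul_of_tower, f.map_smul, hftop, hrad r hr, add_zero] at hz
      have hc : c = 0 := (smul_eq_zero.1 hz).resolve_right hs
      rw [hc, zero_smul, zero_add]
      exact pathsGE_smul_top_mem_radProj hI hr
    · rintro ⟨j, hj, rfl⟩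
      rw [LinearMap.toSpanSingleton_apply, map_smul, hftop]
      obtain ⟨c, hc⟩ := hspan (j • s)
      by_contra hne
      have hc0 : c ≠ 0 := by
        rintro rfl
        rw [zero_smul] at hc
        exact hne hc
      -- `j` acts as the scalar `c ≠ 0`, but `1 - c⁻¹ j` is left invertible
      rw [SetLike.mem_coe, ← Ideal.jacobson_bot, Ideal.mem_jacobson_iff] at hj
      obtain ⟨z, hz⟩ := hj (algebraMap K (Alg I) (-c⁻¹))
      rw [Submodule.mem_bot, sub_eq_zero] at hz
      apply hs
      have h1 := congrArg (fun t => t • s) hz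
      simp only [add_smul, mul_smul, one_smul, hc, algebraMap_smul] at h1
      rw [smul_smul (-c⁻¹) c s, neg_mul, inv_mul_cancel₀ hc0, neg_smul, one_smul, smul_neg, neg_add_cancel] at h1
      exact h1.symm
  exact ⟨((Submodule.quotEquivOfEq _ _ hker.symm).trans
    (f.quotKerEquivOfSurjective hsurj)).symm⟩

end Paths

end BoundQuiver

/-! ### Modules with mast `p` -/

namespace BoundQuiver

theorem take_succ_ofFn {α : Type*} {n : ℕ} (f : Fin n → α) (t : Fin n) :
    (List.ofFn f).take (t + 1) = (List.ofFn f).take t ++ [f t] := by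
  rw [List.take_succ_eq_append_getElem (by rw [List.length_ofFn]; exact t.2), List.getElem_ofFn]

section Mast

variable {V : Type v} [Quiver.{w} V] {l : ℕ} {e : Fin (l + 1) → V} (γ : ∀ i : Fin l, e i.castSucc ⟶ e i.succ)

theorem sub_zero_eq_nil : sub γ 0 = Path.nil := rfl

theorem sub_succ (i : Fin l) : sub γ i.succ = (sub γ i.castSucc).cons (γ i) :=
  Fin.induction_succ _ _ i

theorem length_sub (i : Fin (l + 1)) : (sub γ i).length = i := by
  induction i using Fin.induction with
  | zero => rfl
  | succ i ih => rw [sub_succ, Path.length_cons, ih]; simp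

theorem exists_sub_eq_comp (i : Fin (l + 1)) : ∀ j ≤ i,
    ∃ r : Path (e j) (e i), sub γ i = (sub γ j).comp r := by
  induction i using Fin.induction with
  | zero =>
    intro j hj
    obtain rfl : j = 0 := Fin.le_zero_iff.1 hj
    exact ⟨Path.nil, rfl⟩
  | succ i ih =>
    intro j hj
    rcases hj.eq_or_lt with rfl | hj
    · exact ⟨Path.nil, rfl⟩
    · obtain ⟨r, hr⟩ := ih j (Fin.le_castSucc_iff.2 hj)
      exact ⟨r.cons (γ i), by rw [sub_succ, hr, Path.comp_cons]⟩

theorem length_pos_of_sub_eq_comp {i j : Fin (l + 1)} (hij : j < i) {r : Path (e j) (e i)}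
    (hr : sub γ i = (sub γ j).comp r) : 1 ≤ r.length := by
  have h := congrArg Path.length hr
  rw [Path.length_comp, length_sub, length_sub] at h
  have : (j : ℕ) < i := hij
  omega

theorem vertices_sub (i : Fin (l + 1)) :
    (sub γ i).vertices = (List.ofFn e).take (i + 1) := by
  induction i using Fin.induction with
  | zero => rw [take_succ_ofFn]; rfl
  | succ i ih =>
    rw [sub_succ, Path.vertices_cons, ih, take_succ_ofFn e i.succ, List.concat_eq_append]
    simp

/-- The vertices `e 0, …, e r` of `p_r` use up the first `r + 1` terms of the sequence, so the end
vertex of `α` has to occur later. -/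
theorem exists_lt_of_isRoute {b : V} (r : Fin (l + 1)) (α : e r ⟶ b)
    (h : IsRoute e ((sub γ r).cons α)) : ∃ s, r < s ∧ e s = b := by
  rw [IsRoute, Path.vertices_cons, vertices_sub, List.concat_eq_append,
    List.append_sublist_iff] at h
  obtain ⟨l₁, l₂, hl, h1, h2⟩ := h
  have hlen := h1.length_le
  rw [List.length_take, List.length_ofFn] at hlen
  have hb : b ∈ l₂ := List.singleton_sublist.1 h2
  obtain ⟨n, hn, rfl⟩ := List.getElem_of_mem hb
  have hlen2 := congrArg List.length hl
  rw [List.length_ofFn, List.length_append] at hlen2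
  have hr := r.2
  refine ⟨⟨l₁.length + n, by omega⟩, Fin.lt_def.2 (by simp only; omega), ?_⟩
  have : (List.ofFn e)[l₁.length + n]'(by rw [List.length_ofFn]; omega) = l₂[n] := by
    simp only [hl]
    rw [List.getElem_append_right (by omega)]
    simp
  rw [← this, List.getElem_ofFn]

variable {K : Type u} [Field K] [Fintype V] {I : Ideal (PathAlgebra K V)} [I.IsTwoSided]

/-- A linear combination of the `p_i` with lowest term `p_j` is a multiple of `p_j` by an element
`c + σ`, where `c` is the coefficient of `p_j` and `σ` lies in the arrow ideal. -/
theorem exists_sum_sub_eq (c : Fin (l + 1) → K) (j : Fin (l + 1)) (hc : ∀ i < j, c i = 0) :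
    ∃ σ ∈ pathsGE I 1,
      ∑ i, c i • cls I (sub γ i) = c j • cls I (sub γ j) + σ * cls I (sub γ j) := by
  have h : ∀ i, ∃ σ ∈ pathsGE I 1, i ≠ j → c i • cls I (sub γ i) = σ * cls I (sub γ j) := by
    intro i
    rcases lt_trichotomy i j with h | h | h
    · exact ⟨0, zero_mem _, fun _ => by rw [hc i h, zero_smul, zero_mul]⟩
    · exact ⟨0, zero_mem _, fun hne => absurd h hne⟩
    · obtain ⟨r, hr⟩ := exists_sub_eq_comp γ i j h.le
      refine ⟨c i • cls I r, Submodule.smul_mem _ _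
        (cls_mem_pathsGE I r (length_pos_of_sub_eq_comp γ h hr)), fun _ => ?_⟩
      rw [hr, cls_comp, smul_mul_assoc]
  choose σ hσ hσc using h
  refine ⟨∑ i ∈ Finset.univ.erase j, σ i, sum_mem fun i _ => hσ i, ?_⟩
  rw [← Finset.add_sum_erase _ _ (Finset.mem_univ j), Finset.sum_mul]
  congr 1
  exact Finset.sum_congr rfl fun i hi => hσc i (Finset.ne_of_mem_erase hi)

section Module

variable {U : Type*} [AddCommGroup U] [Module (Alg I) U]

/-- Nakayama's lemma for a single vector: `1 - ρ` is invertible since `ρ` is nilpotent. -/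
theorem eq_zero_of_eq_pathsGE_smul (hI : IsRelationIdeal I) {ρ : Alg I} (hρ : ρ ∈ pathsGE I 1)
    {y : U} (h : y = ρ • y) : y = 0 := by
  have hu := (isNilpotent_of_mem_pathsGE hI hρ).isUnit_one_sub
  refine hu.smul_eq_zero.1 ?_
  rw [sub_smul, one_smul, ← h, sub_self]

variable {x : U}

theorem sub_smul_ne_zero (hpx : cls I (full γ) • x ≠ 0) (i : Fin (l + 1)) :
    cls I (sub γ i) • x ≠ 0 := by
  intro h
  obtain ⟨r, hr⟩ := exists_sub_eq_comp γ (Fin.last l) i (Fin.le_last i)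
  apply hpx
  rw [full, hr, cls_comp, mul_smul, h, smul_zero]

variable [Module K U] [IsScalarTower K (Alg I) U]

theorem sum_smul_sub_smul (c : Fin (l + 1) → K) :
    ∑ i, c i • cls I (sub γ i) • x = (∑ i, c i • cls I (sub γ i)) • x := by
  rw [Finset.sum_smul]
  simp only [smul_assoc]

/-- If `ρ` lies in the arrow ideal, then only the `p_i x` with `i > r` can occur in an expression
of `ρ p_r x` by the vectors `p_i x`: a term of lower degree would generate itself over the
nilpotent arrow ideal. -/
theorem coeff_eq_zero (hI : IsRelationIdeal I) (hpx : cls I (full γ) • x ≠ 0) {r : Fin (l + 1)}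
    {c : Fin (l + 1) → K} {ρ : Alg I} (hρ : ρ ∈ pathsGE I 1)
    (h : ∑ i, c i • cls I (sub γ i) • x = ρ • cls I (sub γ r) • x) :
    ∀ i ≤ r, c i = 0 := by
  have key : ∀ n : ℕ, ∀ i ≤ r, (i : ℕ) = n → c i = 0 := by
    intro n
    induction n using Nat.strong_induction_on with
    | _ n ih =>
      rintro i hir rfl
      obtain ⟨σ, hσ, hsum⟩ := exists_sum_sub_eq (I := I) γ c i
        fun j hj => ih j hj j (hj.le.trans hir) rfl
      obtain ⟨q, hq⟩ := exists_sub_eq_comp γ r i hir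
      rw [sum_smul_sub_smul, hsum, hq, cls_comp, add_smul, mul_smul, mul_smul, smul_assoc] at h
      by_contra hc
      refine sub_smul_ne_zero γ hpx i (eq_zero_of_eq_pathsGE_smul hI
        (Submodule.smul_mem _ (c i)⁻¹
          (sub_mem (mul_mem_pathsGE_left I hρ (cls I q)) hσ)) ?_)
      rw [smul_assoc, sub_smul, mul_smul, ← h, add_sub_cancel_right, smul_smul,
        inv_mul_cancel₀ hc, one_smul]
  exact fun i hi => key i i hi rfl

theorem sub_smul_independent (hI : IsRelationIdeal I) (hpx : cls I (full γ) • x ≠ 0)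
    {c : Fin (l + 1) → K} (h : ∑ i, c i • cls I (sub γ i) • x = 0) (i : Fin (l + 1)) : c i = 0 :=
  coeff_eq_zero γ hI hpx (r := Fin.last l) (ρ := 0) (zero_mem _) (by rw [h, zero_smul]) i
    (Fin.le_last i)

theorem coeff_unique (hI : IsRelationIdeal I) (hpx : cls I (full γ) • x ≠ 0)
    {c c' : Fin (l + 1) → K}
    (h : ∑ i, c i • cls I (sub γ i) • x = ∑ i, c' i • cls I (sub γ i) • x) : c = c' := by
  funext i
  refine sub_eq_zero.1 (sub_smul_independent γ hI hpx (c := fun i => c i - c' i) ?_ i)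
  simp only [sub_smul, Finset.sum_sub_distrib, h, sub_self]

end Module

/-! ### Uniserial modules with mast `p` -/

section Filtration

variable {U : Type*} [AddCommGroup U] [Module (Alg I) U] {M : Fin (l + 2) → Submodule (Alg I) U}

/-- An element of `Λ` which kills the `i`-th composition factor maps `M i` into `M (i + 1)`. -/
theorem smul_mem_succ {i : Fin (l + 1)}
    (hM : Nonempty ((M i.castSucc ⧸ (M i.succ).submoduleOf (M i.castSucc)) ≃ₗ[Alg I]
      Simple I (e i))) {a : Alg I} (ha : ∀ s : Simple I (e i), a • s = 0) {y : U}
    (hy : y ∈ M i.castSucc) : a • y ∈ M i.succ := by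
  obtain ⟨φ⟩ := hM
  have h : a • (Submodule.Quotient.mk ⟨y, hy⟩ :
      M i.castSucc ⧸ (M i.succ).submoduleOf (M i.castSucc)) = 0 := by
    apply φ.injective
    rw [φ.map_smul, ha, φ.map_zero]
  rw [← Submodule.Quotient.mk_smul, Submodule.Quotient.mk_eq_zero] at h
  exact h

theorem exists_level (h0 : M 0 = ⊤) (hlast : M (Fin.last (l + 1)) = ⊥) {y : U} (hy : y ≠ 0) :
    ∃ i : Fin (l + 1), y ∈ M i.castSucc ∧ y ∉ M i.succ := by
  by_contra! h
  have : ∀ n, y ∈ M n := by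
    intro n
    induction n using Fin.induction with
    | zero => rw [h0]; trivial
    | succ i ih => exact h i ih
  have hl := this (Fin.last (l + 1))
  rw [hlast] at hl
  exact hy hl

variable (hI : IsRelationIdeal I) (hM : ∀ i : Fin (l + 1), M i.succ ≤ M i.castSucc ∧
    Nonempty ((M i.castSucc ⧸ (M i.succ).submoduleOf (M i.castSucc)) ≃ₗ[Alg I] Simple I (e i)))

include hI hM

theorem arrow_smul_mem {i : Fin (l + 1)} {y : U} (hy : y ∈ M i.castSucc) {b c : V} (α : b ⟶ c) :
    cls I α.toPath • y ∈ M i.succ :=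
  smul_mem_succ (hM i).2
    (pathsGE_smul_simple hI (cls_mem_pathsGE I α.toPath (by simp))) hy

theorem nil_smul_mem {i : Fin (l + 1)} {y : U} (hy : y ∈ M i.castSucc) {b : V} (hb : b ≠ e i) :
    cls I (Path.nil : Path b b) • y ∈ M i.succ :=
  smul_mem_succ (hM i).2 (nil_smul_simple hI hb) hy

variable (h0 : M 0 = ⊤)

include h0

theorem pathsGE_smul_mem (n : Fin (l + 2)) : ∀ ρ ∈ pathsGE I n, ∀ y : U, ρ • y ∈ M n := by
  let : Module K U := Module.compHom U (algebraMap K (Alg I))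
  have : IsScalarTower K (Alg I) U :=
    ⟨fun c a u => by rw [Algebra.smul_def, mul_smul]; rfl⟩
  induction n using Fin.induction with
  | zero => intro ρ _ y; rw [h0]; trivial
  | succ i ih =>
    intro ρ hρ y
    induction hρ using Submodule.span_induction with
    | zero => rw [zero_smul]; exact zero_mem _
    | add x x' _ _ hx hx' => rw [add_smul]; exact add_mem hx hx'
    | smul c x _ hx => rw [smul_assoc]; exact (M i.succ).smul_of_tower_mem c hx
    | mem x hx =>
      obtain ⟨a, b, q, hq, rfl⟩ := hx
      cases q with
      | nil => simp at hq
      | cons q α =>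
        rw [cls_cons, mul_smul]
        exact arrow_smul_mem hI hM (ih _ (cls_mem_pathsGE I q (by simpa using hq)) y) α

variable (hlast : M (Fin.last (l + 1)) = ⊥)

include hlast

/-- If `p U ≠ 0`, then `p x ≠ 0` for a generator `x = e x`: here `U = K x + J x`, and `p J` lies in
`J ^ (l + 1)`, which kills `U`. -/
theorem full_smul_ne_zero {x y : U} (hy : cls I (full γ) • y ≠ 0)
    (hspan : Submodule.span (Alg I) {x} = ⊤) (hx : cls I (Path.nil : Path (e 0) (e 0)) • x = x) :
    cls I (full γ) • x ≠ 0 := by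
  intro hpx
  apply hy
  have : y ∈ Submodule.span (Alg I) {x} := hspan ▸ Submodule.mem_top
  obtain ⟨a, rfl⟩ := Submodule.mem_span_singleton.1 this
  obtain ⟨c, r, hr, hz⟩ := exists_eq_smul_top_add (a • top I (e 0))
  have hz' := congrArg (fun z : Proj I (e 0) => (z : Alg I) • x) hz
  have hr' : cls I (full γ) • r • x = 0 := by
    have := pathsGE_smul_mem hI hM h0 (Fin.last (l + 1)) (cls I (full γ) * r)
      (mul_mem_pathsGE I (cls_mem_pathsGE I (full γ) (n := l) (by simp [length_sub])) hr) x
    rwa [hlast, Submodule.mem_bot, mul_smul] at this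
  have hz'' : a • x = algebraMap K (Alg I) c • x + r • x := by
    rw [← algebraMap_smul (Alg I) c (top I (e 0))] at hz'
    simpa only [Submodule.coe_add, Submodule.coe_smul, coe_top, smul_eq_mul, add_smul, mul_smul,
      hx] using hz'
  rw [hz'', smul_add, hr', add_zero, ← mul_smul, ← Algebra.commutes, mul_smul, hpx, smul_zero]

/-- If `q x` lies in the layer `t`, then the vertices of `q` form a subsequence of `(e 0, …, e t)`:
each arrow strictly raises the layer, and the layer determines the end vertex. -/
theorem vertices_sublist {x : U} {b : V} (q : Path (e 0) b) :
    ∀ t : Fin (l + 1), cls I q • x ∈ M t.castSucc → cls I q • x ∉ M t.succ →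
      q.vertices.Sublist ((List.ofFn e).take (t + 1)) := by
  have hend : ∀ {b : V} (q : Path (e 0) b) (t : Fin (l + 1)), cls I q • x ∈ M t.castSucc →
      cls I q • x ∉ M t.succ → b = e t := by
    intro b q t h1 h2
    by_contra hb
    apply h2
    have := nil_smul_mem hI hM h1 hb
    rwa [← mul_smul, cls_nil_mul] at this
  have hanti : Antitone M := Fin.antitone_iff_succ_le.2 fun i => (hM i).1
  induction q with
  | nil =>
    intro t h1 h2
    rw [take_succ_ofFn, ← hend Path.nil t h1 h2, Path.vertices_nil]
    exact List.sublist_append_right _ _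
  | cons q α ih =>
    intro t h1 h2
    have hq : cls I q • x ≠ 0 := by
      intro h
      apply h2
      rw [cls_cons, mul_smul, h, smul_zero]
      exact zero_mem _
    obtain ⟨t', h1', h2'⟩ := exists_level h0 hlast hq
    have hlt : t' < t := by
      by_contra hle
      apply h2
      rw [cls_cons, mul_smul]
      exact hanti (Fin.succ_le_succ_iff.2 (not_lt.1 hle)) (arrow_smul_mem hI hM h1' α)
    rw [take_succ_ofFn, ← hend (q.cons α) t h1 h2, Path.vertices_cons, List.concat_eq_append]
    refine List.Sublist.append ((ih t' h1' h2').trans ?_) (List.Sublist.refl _)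
    exact (List.take_sublist_take_left (Nat.succ_le_of_lt hlt))

theorem smul_eq_zero_of_not_isRoute {x : U} {b : V} (q : Path (e 0) b) (hq : ¬ IsRoute e q) : cls I q • x = 0 := by
  by_contra h
  obtain ⟨t, h1, h2⟩ := exists_level h0 hlast h
  exact hq ((vertices_sublist hI hM h0 hlast q t h1 h2).trans (List.take_sublist _ _))

end Filtration

section OfMast

variable {U : Type*} [AddCommGroup U] [Module (Alg I) U] [Module K U] [IsScalarTower K (Alg I) U]
  {x : U}

/-- `λ p_i x` is a combination of the vectors `p_j x` with `j ≥ i`, and with `j > i` if `λ` lies in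
the arrow ideal. -/
theorem exists_coeff_pathsGE (hI : IsRelationIdeal I) (hpx : cls I (full γ) • x ≠ 0)
    (hspan : ∀ u : U, ∃ c : Fin (l + 1) → K, u = ∑ i, c i • cls I (sub γ i) • x)
    {ρ : Alg I} (hρ : ρ ∈ pathsGE I 1) (r : Fin (l + 1)) :
    ∃ c : Fin (l + 1) → K, (∀ i ≤ r, c i = 0) ∧
      ρ • cls I (sub γ r) • x = ∑ i, c i • cls I (sub γ i) • x := by
  obtain ⟨c, hc⟩ := hspan (ρ • cls I (sub γ r) • x)
  exact ⟨c, coeff_eq_zero γ hI hpx hρ hc.symm, hc⟩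

theorem exists_eq_smul_sub_add (r : Fin (l + 1)) (a : Alg I) : ∃ (c : K) (ρ : Alg I),
    ρ ∈ pathsGE I 1 ∧ a • cls I (sub γ r) • x
      = c • cls I (sub γ r) • x + ρ • cls I (sub γ r) • x := by
  obtain ⟨c, ρ, hρ, hz⟩ := exists_eq_smul_top_add (a • top I (e r))
  refine ⟨c, ρ, hρ, ?_⟩
  have hz' := congrArg (fun z : Proj I (e r) => (z : Alg I) • cls I (sub γ r) • x) hz
  simpa only [Submodule.coe_add, Submodule.coe_smul, Submodule.coe_smul_of_tower, coe_top,
    smul_eq_mul, add_smul, mul_smul, smul_assoc, ← mul_smul (cls I Path.nil) (cls I (sub γ r)) x, cls_nil_mul] using hz'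

/-- The submodule spanned by the vectors `p_i x` with `i ≥ n`. -/
def mastSpan (hI : IsRelationIdeal I) (hpx : cls I (full γ) • x ≠ 0)
    (hspan : ∀ u : U, ∃ c : Fin (l + 1) → K, u = ∑ i, c i • cls I (sub γ i) • x) (n : ℕ) :
    Submodule (Alg I) U where
  carrier := {u | ∃ c : Fin (l + 1) → K, (∀ i : Fin (l + 1), (i : ℕ) < n → c i = 0) ∧
    u = ∑ i, c i • cls I (sub γ i) • x}
  zero_mem' := ⟨0, fun _ _ => rfl, by simp⟩
  add_mem' := by
    rintro _ _ ⟨c, hc, rfl⟩ ⟨c', hc', rfl⟩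
    refine ⟨c + c', fun i hi => by simp [hc i hi, hc' i hi], ?_⟩
    simp [add_smul, Finset.sum_add_distrib]
  smul_mem' := by
    rintro a _ ⟨c, hc, rfl⟩
    have h : ∀ i, ∃ d : Fin (l + 1) → K, (∀ j : Fin (l + 1), (j : ℕ) < n → d j = 0) ∧
        a • c i • cls I (sub γ i) • x = ∑ j, d j • cls I (sub γ j) • x := by
      intro i
      by_cases hi : (i : ℕ) < n
      · exact ⟨0, fun _ _ => rfl, by simp [hc i hi]⟩
      obtain ⟨d, ρ, hρ, hd⟩ := exists_eq_smul_sub_add (x := x) γ i a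
      obtain ⟨f, hf, hρf⟩ := exists_coeff_pathsGE γ hI hpx hspan hρ i
      refine ⟨fun j => c i * ((Pi.single i d : Fin (l + 1) → K) j + f j), fun j hj => ?_, ?_⟩
      · have hji : j < i := Fin.lt_def.2 (hj.trans_le (not_lt.1 hi))
        simp [hf j hji.le, Pi.single_eq_of_ne hji.ne]
      · rw [smul_comm, hd, hρf]
        simp only [mul_smul, ← Finset.smul_sum, add_smul, Finset.sum_add_distrib]
        simp [Pi.single_apply, smul_add]
    choose d hd hsum using h
    refine ⟨∑ i, d i, fun j hj => ?_, ?_⟩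
    · rw [Finset.sum_apply]
      exact Finset.sum_eq_zero fun i _ => hd i j hj
    · rw [Finset.smul_sum]
      simp only [hsum, Finset.sum_apply, Finset.sum_smul]
      exact Finset.sum_comm

variable (hI : IsRelationIdeal I) (hpx : cls I (full γ) • x ≠ 0)
  (hspan : ∀ u : U, ∃ c : Fin (l + 1) → K, u = ∑ i, c i • cls I (sub γ i) • x)

theorem mastSpan_antitone : Antitone (mastSpan γ hI hpx hspan) := by
  rintro m n hmn _ ⟨c, hc, rfl⟩
  exact ⟨c, fun i hi => hc i (hi.trans_le hmn), rfl⟩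

theorem sub_smul_mem_mastSpan (i : Fin (l + 1)) :
    cls I (sub γ i) • x ∈ mastSpan γ hI hpx hspan i := by
  refine ⟨Pi.single i 1, fun j hj => Pi.single_eq_of_ne (Fin.ne_of_lt hj) _, ?_⟩
  rw [Finset.sum_eq_single i]
  · simp
  · intro j _ hj
    rw [Pi.single_eq_of_ne hj, zero_smul]
  · simp

/-- A vector `u = (c + σ) p_n x` with lowest term `c p_n x` generates `p_n x`, since `c + σ` is
invertible for nilpotent `σ`. -/
theorem exists_mastSpan_eq_span (u : U) : ∃ n : ℕ, u ∈ mastSpan γ hI hpx hspan n ∧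
    mastSpan γ hI hpx hspan n ≤ Submodule.span (Alg I) {u} := by
  obtain ⟨c, hc⟩ := hspan u
  by_cases h0 : ∀ i, c i = 0
  · refine ⟨l + 1, ⟨c, fun i _ => h0 i, hc⟩, ?_⟩
    rintro _ ⟨d, hd, rfl⟩
    simp [hd _ (Fin.is_lt _)]
  push Not at h0
  obtain ⟨i, hi, hmin⟩ := WellFounded.has_min (wellFounded_lt (α := Fin (l + 1)))
    {i | c i ≠ 0} h0
  have hlow : ∀ j < i, c j = 0 := fun j hj => by
    by_contra h
    exact hmin j h hj
  refine ⟨i, ⟨c, fun j hj => hlow j hj, hc⟩, ?_⟩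
  obtain ⟨σ, hσ, hsum⟩ := exists_sum_sub_eq (I := I) γ c i hlow
  obtain ⟨v, hv⟩ := (isNilpotent_of_mem_pathsGE hI
    (Submodule.smul_mem _ (c i)⁻¹ hσ)).isUnit_one_add
  have hmem : cls I (sub γ i) • x ∈ Submodule.span (Alg I) {u} := by
    refine Submodule.mem_span_singleton.2 ⟨(↑v⁻¹ : Alg I) * algebraMap K (Alg I) (c i)⁻¹, ?_⟩
    have h1 : algebraMap K (Alg I) (c i)⁻¹ • u = (v : Alg I) • cls I (sub γ i) • x := by
      rw [hv, hc, sum_smul_sub_smul, hsum, algebraMap_smul, add_smul, smul_add, mul_smul,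
        add_smul, one_smul, smul_assoc, smul_assoc, smul_smul, inv_mul_cancel₀ hi, one_smul]
    rw [mul_smul, h1, ← mul_smul, Units.inv_mul, one_smul]
  rintro _ ⟨d, hd, rfl⟩
  refine sum_mem fun j _ => ?_
  by_cases hj : (j : ℕ) < i
  · rw [hd j hj, zero_smul]
    exact zero_mem _
  · obtain ⟨r, hr⟩ := exists_sub_eq_comp γ j i (not_lt.1 hj)
    rw [hr, cls_comp, mul_smul]
    exact Submodule.smul_of_tower_mem _ _ (Submodule.smul_mem _ _ hmem)

include hI hpx hspan in
/-- If the vectors `p_0 x, …, p_l x` span `U` and `p x ≠ 0`, then the submodules `mastSpan` form the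
only composition series of `U`, with factors `S(e 0), …, S(e l)`. -/
theorem isUniserialWith_of_mast : IsUniserialWith I e U := by
  set W := mastSpan γ hI hpx hspan
  refine ⟨?_, fun i => W i, ?_, ?_, fun i => ⟨mastSpan_antitone γ hI hpx hspan (by simp), ?_⟩⟩
  · intro N _ N' _ _
    by_cases hle : N ≤ N'
    · exact Or.inl hle
    · right
      obtain ⟨u, hu, hu'⟩ := SetLike.not_le_iff_exists.1 hle
      intro y hy
      obtain ⟨n, hn, hn'⟩ := exists_mastSpan_eq_span γ hI hpx hspan u
      obtain ⟨n', hy1, hy2⟩ := exists_mastSpan_eq_span γ hI hpx hspan y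
      rcases le_total n n' with h | h
      · exact (hn'.trans ((Submodule.span_singleton_le_iff_mem _ _).2 hu))
          (mastSpan_antitone γ hI hpx hspan h hy1)
      · exact absurd ((hy2.trans ((Submodule.span_singleton_le_iff_mem _ _).2 hy))
          (mastSpan_antitone γ hI hpx hspan h hn)) hu'
  · refine eq_top_iff.2 fun u _ => ?_
    obtain ⟨c, hc⟩ := hspan u
    exact ⟨c, fun i hi => absurd hi (Nat.not_lt_zero _), hc⟩
  · refine eq_bot_iff.2 ?_
    rintro _ ⟨c, hc, rfl⟩
    exact Finset.sum_eq_zero fun i _ => by rw [hc i i.2, zero_smul]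
  · have hmem : cls I (sub γ i) • x ∈ W (i.castSucc : ℕ) := sub_smul_mem_mastSpan γ hI hpx hspan i
    refine nonempty_equiv_simple hI (s := Submodule.Quotient.mk ⟨_, hmem⟩) ?_ ?_ ?_ ?_
    · rw [Ne, Submodule.Quotient.mk_eq_zero]
      rintro ⟨c, hc, hsum⟩
      have h1 := coeff_unique γ hI hpx (x := x) (c := Pi.single i 1) (c' := c) (by
        rw [← hsum]
        simp [Pi.single_apply])
      have h2 := congrFun h1 i
      rw [hc i (by simp)] at h2
      simp at h2
    · intro y
      obtain ⟨⟨_, c, hc, rfl⟩, rfl⟩ := Submodule.Quotient.mk_surjective _ y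
      refine ⟨c i, ?_⟩
      rw [← Submodule.Quotient.mk_smul, Submodule.Quotient.eq]
      refine ⟨c - Pi.single i (c i), fun j hj => ?_, ?_⟩
      · rcases eq_or_ne j i with rfl | hji
        · simp
        · have : (j : ℕ) < i :=
            lt_of_le_of_ne (Nat.lt_succ_iff.1 (by simpa using hj)) (Fin.val_ne_of_ne hji)
          simp [hc j (by simpa using this), Pi.single_eq_of_ne hji]
      · simp [sub_smul, Finset.sum_sub_distrib, Pi.single_apply]
    · rw [← Submodule.Quotient.mk_smul]
      congr 1
      exact Subtype.ext (by simp [← mul_smul, cls_nil_mul])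
    · intro ρ hρ
      rw [← Submodule.Quotient.mk_smul, Submodule.Quotient.mk_eq_zero]
      obtain ⟨c, hc, hsum⟩ := exists_coeff_pathsGE γ hI hpx hspan hρ i
      refine ⟨c, fun j hj => hc j ?_, hsum⟩
      exact Nat.lt_succ_iff.1 (by simpa using hj)

include hI hpx hspan in
/-- In a module with mast `p`, the value of a detour is a combination of the `p_i x` with `i` in its
index set. -/
theorem exists_detour_coeff (d : Detour I γ) : ∃ k : d.Idx → K,
    cls I d.path • x = ∑ i : d.Idx, k i • cls I (sub γ i.1) • x := by
  obtain ⟨c, hc, hsum⟩ := exists_coeff_pathsGE γ hI hpx hspan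
    (cls_mem_pathsGE I d.α.toPath (n := 1) (by simp)) d.m
  classical
  -- the idempotent of the end vertex of the detour kills the other terms
  have h1 : ∀ i, cls I (Path.nil : Path d.b d.b) • c i • cls I (sub γ i) • x
      = (if e i = d.b then c i else 0) • cls I (sub γ i) • x := by
    intro i
    rw [smul_comm, ← mul_smul]
    split_ifs with h
    · rw [← h, cls_nil_mul]
    · rw [cls_mul_eq_zero I _ _ (Ne.symm h), zero_smul, smul_zero, zero_smul]
  have h2 := congrArg (fun y => cls I (Path.nil : Path d.b d.b) • y) hsum
  simp only [Finset.smul_sum, h1] at h2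
  rw [← mul_smul, cls_nil_mul, hsum] at h2
  have h3 := coeff_unique γ hI hpx h2
  have h4 : ∀ i, ¬ (d.m < i ∧ e i = d.b) → c i = 0 := by
    intro i hi
    by_cases him : d.m < i
    · have := congrFun h3 i
      rwa [if_neg fun h => hi ⟨him, h⟩] at this
    · exact hc i (not_lt.1 him)
  refine ⟨fun i => c i, ?_⟩
  rw [Detour.path, cls_cons, mul_smul, hsum]
  have h5 := Finset.sum_subtype (F := inferInstanceAs (Fintype d.Idx)) (Finset.univ.filter fun i => d.m < i ∧ e i = d.b)
    (p := fun i => d.m < i ∧ e i = d.b) (by simp) (fun i => c i • cls I (sub γ i) • x)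
  rw [← h5]
  refine (Finset.sum_subset (Finset.subset_univ _) fun i _ hi => ?_).symm
  rw [h4 i (by simpa using hi), zero_smul]

end OfMast

end Mast

end BoundQuiver

/-! ### The submodules `ψ_p(k)` -/

namespace BoundQuiver

section Psi

variable {K : Type u} [Field K] {V : Type v} [Quiver.{w} V] [Fintype V]
  {I : Ideal (PathAlgebra K V)} [I.IsTwoSided]
  {l : ℕ} {e : Fin (l + 1) → V} (γ : ∀ i : Fin l, e i.castSucc ⟶ e i.succ)

theorem elt_full_ne_zero
    (hp : (PathAlgebra.single (.of (full γ)) : PathAlgebra K V) ∉ I) : elt I (full γ) ≠ 0 := by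
  intro h
  apply hp
  rw [← cls_eq_zero, ← coe_elt, h]
  rfl

theorem linearIndependent_elt_sub (hI : IsRelationIdeal I)
    (hp : (PathAlgebra.single (.of (full γ)) : PathAlgebra K V) ∉ I) :
    LinearIndependent K fun i : Fin (l + 1) => elt I (sub γ i) :=
  Fintype.linearIndependent_iff.2 fun _ hc i =>
    sub_smul_independent γ hI (x := top I (e 0)) (elt_full_ne_zero γ hp) hc i

open MvPolynomial in
/-- Modulo `ψ_p(k)`, an arrow times a right subpath of `p` is a combination of right subpaths whose
coefficients are polynomials in `k`: it is zero, the next subpath, a detour or not a route. -/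
theorem exists_poly_arrow {c b : V} (α : c ⟶ b) (i : Fin (l + 1)) :
    ∃ F : Fin (l + 1) → MvPolynomial (Coord I γ) K, ∀ k : Coord I γ → K,
      cls I α.toPath • elt I (sub γ i) - ∑ j, eval k (F j) • elt I (sub γ j) ∈ psi I γ k := by
  classical
  by_cases hc : c = e i
  swap
  · have : cls I α.toPath • elt I (sub γ i) = 0 :=
      Subtype.ext (by rw [Submodule.coe_smul, coe_elt]; exact cls_mul_eq_zero I _ _ hc)
    exact ⟨0, fun k => by simp [this]⟩
  subst hc
  rw [cls_smul_elt]
  change ∃ F : Fin (l + 1) → MvPolynomial (Coord I γ) K, ∀ k : Coord I γ → K,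
      elt I ((sub γ i).cons α) - ∑ j, eval k (F j) • elt I (sub γ j) ∈ psi I γ k
  by_cases h1 : (PathAlgebra.single (.of ((sub γ i).cons α)) : PathAlgebra K V) ∈ I
  · have : elt I ((sub γ i).cons α) = 0 :=
      Subtype.ext (by rw [coe_elt, (cls_eq_zero I).2 h1]; rfl)
    exact ⟨0, fun k => by simp [this]⟩
  by_cases h2 : ∃ j : Fin l, j.castSucc = i ∧
    PathIdx.of ((sub γ i).cons α) = PathIdx.of (sub γ j.succ)
  · obtain ⟨j, -, hj⟩ := h2
    refine ⟨Pi.single j.succ 1, fun k => ?_⟩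
    rw [elt_congr I hj, Finset.sum_eq_single j.succ]
    · simp
    · intro j' _ hj'
      rw [Pi.single_eq_of_ne hj', map_zero, zero_smul]
    · simp
  by_cases h3 : ∃ s : Fin (l + 1), i < s ∧ e s = b
  · let d : Detour I γ := ⟨i, b, α, h1, fun j hj h => h2 ⟨j, hj, h⟩, h3⟩
    refine ⟨fun j => ∑ s : d.Idx, (Pi.single s.1 (X ⟨d, s⟩) :
      Fin (l + 1) → MvPolynomial (Coord I γ) K) j, fun k => ?_⟩
    have hsum : ∑ j, eval k (∑ s : d.Idx, (Pi.single s.1 (X ⟨d, s⟩) :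
        Fin (l + 1) → MvPolynomial (Coord I γ) K) j) • elt I (sub γ j)
        = ∑ s : d.Idx, k ⟨d, s⟩ • elt I (sub γ s.1) := by
      simp only [map_sum, Finset.sum_smul]
      rw [Finset.sum_comm]
      refine Finset.sum_congr rfl fun s _ => ?_
      rw [Finset.sum_eq_single s.1]
      · simp
      · intro j' _ hj'
        rw [Pi.single_eq_of_ne hj', map_zero, zero_smul]
      · simp
    rw [hsum]
    exact Submodule.subset_span (Or.inl ⟨d, rfl⟩)
  · refine ⟨0, fun k => ?_⟩
    simp only [Pi.zero_apply, map_zero, zero_smul, Finset.sum_const_zero, sub_zero]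
    exact Submodule.subset_span (Or.inr ⟨b, _, fun h => h3 (exists_lt_of_isRoute γ i α h), rfl⟩)

open MvPolynomial in
/-- Modulo `ψ_p(k)`, every element of `Λ e` is a combination of the right subpaths of `p`, with
coefficients which are polynomials in `k`. -/
theorem exists_poly (z : Proj I (e 0)) :
    ∃ F : Fin (l + 1) → MvPolynomial (Coord I γ) K, ∀ k : Coord I γ → K,
      z - ∑ j, eval k (F j) • elt I (sub γ j) ∈ psi I γ k := by
  refine proj_induction I (P := fun z => ∃ F : Fin (l + 1) → MvPolynomial (Coord I γ) K,
    ∀ k : Coord I γ → K, z - ∑ j, eval k (F j) • elt I (sub γ j) ∈ psi I γ k) z ?_ ?_ ?_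
  · exact ⟨0, fun k => by simp⟩
  · rintro z z' ⟨F, hF⟩ ⟨F', hF'⟩
    refine ⟨F + F', fun k => ?_⟩
    have := add_mem (hF k) (hF' k)
    simp only [Pi.add_apply, map_add, add_smul, Finset.sum_add_distrib]
    convert this using 1
    abel
  · intro c b q
    have hq : ∃ F : Fin (l + 1) → MvPolynomial (Coord I γ) K,
        ∀ k : Coord I γ → K, elt I q - ∑ j, eval k (F j) • elt I (sub γ j) ∈ psi I γ k := by
      induction q with
      | nil =>
        classical
        refine ⟨Pi.single 0 1, fun k => ?_⟩
        rw [Finset.sum_eq_single 0]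
        · simp [sub_zero_eq_nil]
        · intro j' _ hj'
          rw [Pi.single_eq_of_ne hj', map_zero, zero_smul]
        · simp
      | cons q α ih =>
        obtain ⟨F, hF⟩ := ih
        choose G hG using fun i => exists_poly_arrow (I := I) γ α i
        refine ⟨fun j => ∑ i, F i * G i j, fun k => ?_⟩
        have h1 := Submodule.smul_mem _ (cls I α.toPath) (hF k)
        have h2 : ∑ i, eval k (F i) • (cls I α.toPath • elt I (sub γ i)
            - ∑ j, eval k (G i j) • elt I (sub γ j)) ∈ psi I γ k :=
          sum_mem fun i _ => Submodule.smul_of_tower_mem _ _ (hG i k)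
        have h3 := add_mem h1 h2
        rw [smul_sub, cls_smul_elt] at h3
        convert h3 using 1
        simp only [Hom.toPath, Path.comp_cons, Path.comp_nil, map_sum, map_mul, Finset.sum_smul,
          smul_sub, Finset.sum_sub_distrib, Finset.smul_sum, smul_smul]
        rw [Finset.sum_comm]
        simp only [smul_comm (eval k _) (cls I _), sub_add_sub_cancel]
    obtain ⟨F, hF⟩ := hq
    refine ⟨fun j => C c * F j, fun k => ?_⟩
    have := (psi I γ k).smul_of_tower_mem c (hF k)
    simpa only [smul_sub, Finset.smul_sum, smul_smul, map_mul, eval_C] using this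

theorem spanA_sup_psi (k : Coord I γ → K) :
    spanA I γ ⊔ (psi I γ k).restrictScalars K = ⊤ := by
  refine eq_top_iff.2 fun z _ => ?_
  obtain ⟨F, hF⟩ := exists_poly γ z
  refine Submodule.mem_sup.2 ⟨_, ?_, _, hF k, add_sub_cancel _ _⟩
  exact sum_mem fun j _ => Submodule.smul_mem _ _ (Submodule.subset_span ⟨j, rfl⟩)

theorem mem_spanA {z : Proj I (e 0)} :
    z ∈ spanA I γ ↔ ∃ c : Fin (l + 1) → K, ∑ i, c i • elt I (sub γ i) = z :=
  Submodule.mem_span_range_iff_exists_fun K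

variable {γ}

/-- For `k ∈ V_p`, witnessed by `U = Λ x`, the submodule `ψ_p(k)` kills `x`, while the vectors `p_i x`
are linearly independent; hence `ψ_p(k)` complements `A_p`. -/
theorem isCompl_psi (hI : IsRelationIdeal I) {k : Coord I γ → K} (hk : k ∈ uniVar I γ) :
    IsCompl (spanA I γ) ((psi I γ k).restrictScalars K) := by
  obtain ⟨U, _, _, x, ⟨-, M, h0, hlast, hM⟩, ⟨y, hy⟩, hspan, hx, hd⟩ := hk
  let : Module K U := Module.compHom U (algebraMap K (Alg I))
  have : IsScalarTower K (Alg I) U :=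
    ⟨fun c a u => by rw [Algebra.smul_def, mul_smul]; rfl⟩
  have hpx := full_smul_ne_zero γ hI hM h0 hlast hy hspan hx
  let f : Proj I (e 0) →ₗ[Alg I] U :=
    (LinearMap.toSpanSingleton (Alg I) U x).domRestrict (Proj I (e 0))
  have hf : ∀ {b : V} (q : Path (e 0) b), f (elt I q) = cls I q • x := fun q => by
    change (elt I q : Alg I) • x = _
    rw [coe_elt]
  have hle : psi I γ k ≤ LinearMap.ker f := by
    refine Submodule.span_le.2 ?_
    rintro z (⟨d, rfl⟩ | ⟨b, q, hq, rfl⟩)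
    · rw [SetLike.mem_coe, LinearMap.mem_ker, map_sub, map_sum, hf, hd, sub_eq_zero,
        Finset.sum_smul]
      refine Finset.sum_congr rfl fun i _ => ?_
      rw [f.map_smul_of_tower, hf, smul_assoc]
    · rw [SetLike.mem_coe, LinearMap.mem_ker, hf]
      exact smul_eq_zero_of_not_isRoute hI hM h0 hlast q hq
  refine ⟨?_, codisjoint_iff.2 (spanA_sup_psi γ k)⟩
  rw [Submodule.disjoint_def]
  intro z hz hz'
  obtain ⟨c, rfl⟩ := (mem_spanA γ).1 hz
  have h := LinearMap.mem_ker.1 (hle hz')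
  simp only [map_sum, f.map_smul_of_tower, hf] at h
  exact Finset.sum_eq_zero fun i _ => by rw [sub_smul_independent γ hI hpx h i, zero_smul]

theorem exists_coeff_mem_psi (k : Coord I γ → K) (d : Detour I γ) : ∃ a : Fin (l + 1) → K,
    (∀ i : d.Idx, a i.1 = k ⟨d, i⟩) ∧
      elt I d.path - ∑ i, a i • elt I (sub γ i) ∈ psi I γ k := by
  classical
  refine ⟨fun j => ∑ s : d.Idx, (Pi.single s.1 (k ⟨d, s⟩) : Fin (l + 1) → K) j, fun i => ?_, ?_⟩
  · simp only
    rw [Finset.sum_eq_single i]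
    · simp
    · intro s _ hs
      exact Pi.single_eq_of_ne (fun h => hs (Subtype.ext h.symm)) _
    · simp
  · have hsum : ∑ j, (∑ s : d.Idx, (Pi.single s.1 (k ⟨d, s⟩) : Fin (l + 1) → K) j) • elt I (sub γ j)
        = ∑ s : d.Idx, k ⟨d, s⟩ • elt I (sub γ s.1) := by
      simp only [Finset.sum_smul]
      rw [Finset.sum_comm]
      refine Finset.sum_congr rfl fun s _ => ?_
      simp [Pi.single_apply]
    rw [hsum]
    exact Submodule.subset_span (Or.inl ⟨d, rfl⟩)

/-- If `ψ_p(k)` complements `A_p`, then `k` can be read off from `ψ_p(k)`. -/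
theorem coord_eq_of_mem_psi (hI : IsRelationIdeal I)
    (hp : (PathAlgebra.single (.of (full γ)) : PathAlgebra K V) ∉ I) {k : Coord I γ → K}
    (hk : IsCompl (spanA I γ) ((psi I γ k).restrictScalars K)) (d : Detour I γ)
    {a : Fin (l + 1) → K} (ha : elt I d.path - ∑ i, a i • elt I (sub γ i) ∈ psi I γ k)
    (i : d.Idx) : k ⟨d, i⟩ = a i.1 := by
  obtain ⟨c, hc, hmem⟩ := exists_coeff_mem_psi k d
  have h2 := sub_mem ha hmem
  rw [sub_sub_sub_cancel_left] at h2
  have hA : ∀ f : Fin (l + 1) → K, ∑ i, f i • elt I (sub γ i) ∈ spanA I γ :=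
    fun f => (mem_spanA γ).2 ⟨f, rfl⟩
  have h3 := Submodule.disjoint_def.1 hk.1 _ (sub_mem (hA c) (hA a)) h2
  have h4 := congrFun (coeff_unique γ hI (x := top I (e 0)) (elt_full_ne_zero γ hp)
    (sub_eq_zero.1 h3)) i.1
  rw [← h4, hc]

/-- Every submodule complementing `A_p` has the form `ψ_p(k)`: the module `Λ e / C` is uniserial
with mast `p`, and `k` consists of the coefficients of its detours. -/
theorem exists_psi_eq (hI : IsRelationIdeal I)
    (hp : (PathAlgebra.single (.of (full γ)) : PathAlgebra K V) ∉ I)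
    {C : Submodule (Alg I) (Proj I (e 0))} (hC : IsCompl (spanA I γ) (C.restrictScalars K)) :
    ∃ k ∈ uniVar I γ, psi I γ k = C := by
  set x : Proj I (e 0) ⧸ C := Submodule.Quotient.mk (top I (e 0)) with hxdef
  have hq : ∀ {b : V} (q : Path (e 0) b), cls I q • x = Submodule.Quotient.mk (elt I q) :=
    fun q => rfl
  have hsum : ∀ c : Fin (l + 1) → K, ∑ i, c i • cls I (sub γ i) • x
      = Submodule.Quotient.mk (∑ i, c i • elt I (sub γ i)) := by
    intro c
    rw [← Submodule.mkQ_apply, map_sum]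
    rfl
  have hpx : cls I (full γ) • x ≠ 0 := by
    rw [hq, Ne, Submodule.Quotient.mk_eq_zero]
    intro h
    exact elt_full_ne_zero γ hp (Submodule.disjoint_def.1 hC.1 _
      (Submodule.subset_span ⟨Fin.last l, rfl⟩) h)
  have hspan : ∀ u : Proj I (e 0) ⧸ C, ∃ c : Fin (l + 1) → K,
      u = ∑ i, c i • cls I (sub γ i) • x := by
    intro u
    obtain ⟨z, rfl⟩ := Submodule.Quotient.mk_surjective _ u
    obtain ⟨a, ha, c, hc, rfl⟩ := Submodule.mem_sup.1
      ((codisjoint_iff.1 hC.2).symm ▸ Submodule.mem_top : z ∈ _)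
    obtain ⟨f, rfl⟩ := (mem_spanA γ).1 ha
    refine ⟨f, ?_⟩
    rw [hsum, Submodule.Quotient.eq, add_sub_cancel_left]
    exact hc
  choose k hk using exists_detour_coeff γ hI hpx hspan
  have huni := isUniserialWith_of_mast γ hI hpx hspan
  have hmem : (fun i => k i.1 i.2 : Coord I γ → K) ∈ uniVar I γ := by
    refine ⟨Proj I (e 0) ⧸ C, inferInstance, inferInstance, x, huni, ⟨x, hpx⟩, ?_, ?_, ?_⟩
    · refine eq_top_iff.2 fun u _ => ?_
      obtain ⟨c, rfl⟩ := hspan u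
      refine sum_mem fun i _ => Submodule.smul_of_tower_mem _ _ (Submodule.smul_mem _ _ ?_)
      exact Submodule.mem_span_singleton_self x
    · rw [hq, elt_nil]
    · intro d
      rw [hk d, Finset.sum_smul]
      simp only [smul_assoc]
  refine ⟨_, hmem, ?_⟩
  have hle : psi I γ (fun i => k i.1 i.2) ≤ C := by
    refine Submodule.span_le.2 ?_
    rintro z (⟨d, rfl⟩ | ⟨b, q, hr, rfl⟩)
    · rw [SetLike.mem_coe, ← Submodule.Quotient.mk_eq_zero, Submodule.Quotient.mk_sub, ← hq, hk d,
        sub_eq_zero, ← Submodule.mkQ_apply, map_sum]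
      rfl
    · obtain ⟨-, M, h0, hlast, hM⟩ := huni
      rw [SetLike.mem_coe, ← Submodule.Quotient.mk_eq_zero, ← hq]
      exact smul_eq_zero_of_not_isRoute hI hM h0 hlast q hr
  refine le_antisymm hle fun z hz => ?_
  obtain ⟨a, ha, c, hc, rfl⟩ := Submodule.mem_sup.1
    ((spanA_sup_psi γ fun i => k i.1 i.2).symm ▸ Submodule.mem_top : z ∈ _)
  have : a ∈ C := by simpa using sub_mem hz (hle hc)
  rw [Submodule.disjoint_def.1 hC.1 a ha this, zero_add]
  exact hc

end Psi

end BoundQuiver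

/-! ### Spaces with functions -/

namespace Var

section General

variable {K : Type u} {X : Type*} {Y : Type*} {Z : Type*}

theorem IsMorphism.comp {S : FunSpace K X} {T : FunSpace K Y} {R : FunSpace K Z} {ψ : Y → Z}
    {φ : X → Y} (hψ : IsMorphism T R ψ) (hφ : IsMorphism S T φ) : IsMorphism S R (ψ ∘ φ) := by
  refine ⟨?_, fun U hU f hf => ?_⟩
  · exact continuous_def.2 fun s hs => continuous_def.1 hφ.1 _ (continuous_def.1 hψ.1 s hs)
  · exact hφ.2 _ (continuous_def.1 hψ.1 U hU) _ (hψ.2 U hU f hf)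

theorem isMorphism_induced (S : FunSpace K X) (j : Y → X) : IsMorphism (induced S j) S j := by
  refine ⟨continuous_induced_dom, fun U hU f hf y hy => ?_⟩
  exact ⟨U, f, hU, hf, hy, fun _ _ _ => rfl⟩

/-- Regularity of functions is a local property. -/
def IsLocal (T : FunSpace K Y) : Prop :=
  ∀ (W : Set Y) (f : Y → K), (∀ y ∈ W, ∃ (O : Set Y) (g : Y → K), IsOpen[T.topology] O ∧
    T.IsRegular O g ∧ y ∈ O ∧ ∀ z ∈ W, z ∈ O → f z = g z) → T.IsRegular W f

/-- Regular functions restrict to smaller subsets. -/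
def Restricts (S : FunSpace K X) : Prop :=
  ∀ (U U' : Set X) (f : X → K), U' ⊆ U → S.IsRegular U f → S.IsRegular U' f

theorem restricts_induced (S : FunSpace K X) (j : Y → X) : Restricts (induced S j) := by
  intro U U' f hU hf y hy
  obtain ⟨O, g, hO, hg, hyO, h⟩ := hf y (hU hy)
  exact ⟨O, g, hO, hg, hyO, fun z hz => h z (hU hz)⟩

theorem isLocal_induced {S : FunSpace K X} (hS : Restricts S) (j : Y → X) :
    IsLocal (induced S j) := by
  intro W f h y hy
  obtain ⟨O, g, hO, hg, hyO, hfg⟩ := h y hy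
  obtain ⟨O', hO', rfl⟩ := hO
  obtain ⟨U, g', hU, hg', hyU, hgg'⟩ := hg y hyO
  refine ⟨U ∩ O', g', @IsOpen.inter _ S.topology _ _ hU hO', hS _ _ _ Set.inter_subset_left hg', ⟨hyU, hyO⟩, ?_⟩
  intro z hz hz'
  rw [hfg z hz hz'.2, hgg' z hz'.2 hz'.1]

/-- A map into an induced structure is a morphism if its composite with the inducing map is. -/
theorem IsMorphism.codInduced {S : FunSpace K X} {T : FunSpace K Z} (hT : IsLocal T) {j : Y → X}
    {φ : Z → Y} (h : IsMorphism T S (j ∘ φ)) : IsMorphism T (induced S j) φ := by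
  refine ⟨continuous_induced_rng.2 h.1, fun U _ f hf => hT _ _ fun z hz => ?_⟩
  obtain ⟨O, g, hO, hg, hzO, hfg⟩ := hf (φ z) hz
  exact ⟨(j ∘ φ) ⁻¹' O, g ∘ (j ∘ φ), continuous_def.1 h.1 O hO, h.2 O hO g hg, hzO,
    fun y hy hyO => hfg (φ y) hy hyO⟩

theorem IsIso.symm {S : FunSpace K X} {T : FunSpace K Y} {φ : X ≃ Y} (h : IsIso S T φ) :
    IsIso T S φ.symm :=
  ⟨h.2, by rw [Equiv.symm_symm]; exact h.1⟩

theorem IsIso.trans {S : FunSpace K X} {T : FunSpace K Y} {R : FunSpace K Z} {φ : X ≃ Y}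
    {ψ : Y ≃ Z} (h : IsIso S T φ) (h' : IsIso T R ψ) : IsIso S R (φ.trans ψ) :=
  ⟨h'.1.comp h.1, h.2.comp h'.2⟩

end General

section Affine

variable {K : Type u} [Field K] {ι : Type*}

open MvPolynomial

theorem isOpen_ne_zero (P : MvPolynomial ι K) :
    IsOpen[(affineSpace K ι).topology] {x | eval x P ≠ 0} :=
  TopologicalSpace.isOpen_generateFrom_of_mem ⟨P, rfl⟩

theorem isClosed_eq_zero (P : MvPolynomial ι K) :
    IsClosed[(affineSpace K ι).topology] {x | eval x P = 0} := by
  refine @IsClosed.mk _ (_) _ ?_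
  convert isOpen_ne_zero P using 1
  ext x
  rfl

theorem exists_basic_subset {U : Set (ι → K)} (hU : IsOpen[(affineSpace K ι).topology] U)
    {x : ι → K} (hx : x ∈ U) :
    ∃ P : MvPolynomial ι K, eval x P ≠ 0 ∧ {y | eval y P ≠ 0} ⊆ U := by
  induction hU with
  | basic s hs =>
    obtain ⟨P, rfl⟩ := hs
    exact ⟨P, hx, subset_rfl⟩
  | univ => exact ⟨1, by simp, Set.subset_univ _⟩
  | inter s t _ _ hs ht =>
    obtain ⟨P, hP, hPs⟩ := hs hx.1
    obtain ⟨Q, hQ, hQt⟩ := ht hx.2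
    refine ⟨P * Q, by simp [hP, hQ], fun y hy => ?_⟩
    have hy' : eval y P * eval y Q ≠ 0 := by rw [← map_mul]; exact hy
    exact ⟨hPs (left_ne_zero_of_mul hy'), hQt (right_ne_zero_of_mul hy')⟩
  | sUnion S _ ih =>
    obtain ⟨s, hs, hxs⟩ := hx
    obtain ⟨P, hP, hPs⟩ := ih s hs hxs
    exact ⟨P, hP, hPs.trans (Set.subset_sUnion_of_mem hs)⟩

theorem isLocal_affineSpace : IsLocal (affineSpace K ι) := by
  intro W f h x hx
  obtain ⟨O, g, hO, hg, hxO, hfg⟩ := h x hx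
  obtain ⟨P, Q, hQ, hPQ⟩ := hg x hxO
  obtain ⟨H, hH, hHO⟩ := exists_basic_subset hO hxO
  refine ⟨P * H, Q * H, by simp [hQ, hH], fun y hy hy0 => ?_⟩
  rw [map_mul] at hy0
  have hyH : eval y H ≠ 0 := right_ne_zero_of_mul hy0
  have hyQ : eval y Q ≠ 0 := left_ne_zero_of_mul hy0
  rw [hfg y hy (hHO hyH), hPQ y (hHO hyH) hyQ, map_mul, map_mul, mul_div_mul_right _ _ hyH]

theorem restricts_affineSpace : Restricts (affineSpace K ι) := by
  intro U U' f hU hf x hx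
  obtain ⟨P, Q, hQ, h⟩ := hf x (hU hx)
  exact ⟨P, Q, hQ, fun y hy => h y (hU hy)⟩

theorem eval_bind₁ {κ : Type*} (F : κ → MvPolynomial ι K) (x : ι → K) (P : MvPolynomial κ K) :
    eval x (bind₁ F P) = eval (fun i => eval x (F i)) P := by
  rw [← MvPolynomial.coe_aeval_eq_eval, ← MvPolynomial.coe_aeval_eq_eval]
  change aeval x (bind₁ F P) = _
  rw [aeval_bind₁]
  rfl

/-- Polynomial maps are morphisms. -/
theorem isMorphism_polynomial {κ : Type*} (F : κ → MvPolynomial ι K) :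
    IsMorphism (affineSpace K ι) (affineSpace K κ) fun x i => eval x (F i) := by
  refine ⟨continuous_generateFrom_iff.2 ?_, fun U _ f hf x hx => ?_⟩
  · rintro _ ⟨P, rfl⟩
    convert isOpen_ne_zero (bind₁ F P) using 1
    ext x
    exact not_congr (by rw [eval_bind₁])
  · obtain ⟨P, Q, hQ, h⟩ := hf _ hx
    refine ⟨bind₁ F P, bind₁ F Q, by rwa [eval_bind₁], fun y hy hy0 => ?_⟩
    rw [eval_bind₁] at hy0
    rw [eval_bind₁, eval_bind₁]
    exact h _ hy hy0

/-- An affine variety may be given in an affine space with any finite set of coordinates. -/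
theorem isAffine_of_isIso [Finite ι] {Y : Type*} {S : FunSpace K Y} {Z : Set (ι → K)}
    (hZ : IsClosed[(affineSpace K ι).topology] Z) {φ : Y ≃ Z}
    (hφ : IsIso S (restrict (affineSpace K ι) Z) φ) : IsAffine S := by
  obtain ⟨n, ⟨σ⟩⟩ := Finite.exists_equiv_fin ι
  have h1 : IsMorphism (affineSpace K ι) (affineSpace K (Fin n)) fun x i => x (σ.symm i) := by
    simpa using isMorphism_polynomial (K := K) fun i => (X (σ.symm i) : MvPolynomial ι K)
  have h2 : IsMorphism (affineSpace K (Fin n)) (affineSpace K ι) fun x i => x (σ i) := by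
    simpa using isMorphism_polynomial (K := K) fun i => (X (σ i) : MvPolynomial (Fin n) K)
  let Z' : Set (Fin n → K) := (fun x i => x (σ i)) ⁻¹' Z
  let ψ : Z ≃ Z' :=
    { toFun := fun x => ⟨fun i => x.1 (σ.symm i), by
        change (fun i => x.1 (σ.symm (σ i))) ∈ Z
        simp⟩
      invFun := fun x => ⟨fun i => x.1 (σ i), x.2⟩
      left_inv := fun x => Subtype.ext (by simp)
      right_inv := fun x => Subtype.ext (by simp) }
  refine ⟨n, Z', φ.trans ψ, ?_, hφ.trans ⟨?_, ?_⟩⟩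
  · refine @IsClosed.mk _ (_) _ ?_
    exact continuous_def.1 h2.1 _ (@IsClosed.isOpen_compl _ _ (_) hZ)
  · exact IsMorphism.codInduced (isLocal_induced restricts_affineSpace _)
      (h1.comp (isMorphism_induced _ _))
  · exact IsMorphism.codInduced (isLocal_induced restricts_affineSpace _)
      (h2.comp (isMorphism_induced _ _))

end Affine

section Projective

open scoped LinearAlgebra.Projectivization

variable {K : Type u} [Field K] {W : Type*} [AddCommGroup W] [Module K W]

theorem evalAt_smul {d : ℕ} {F : Poly K W} (hF : F.IsHomogeneous d) (a : K) (x : W) :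
    evalAt (a • x) F = a ^ d * evalAt x F := by
  rw [evalAt, evalAt, MvPolynomial.eval_eq, MvPolynomial.eval_eq, Finset.mul_sum]
  refine Finset.sum_congr rfl fun s hs => ?_
  have hd : ∑ i ∈ s.support, s i = d := by
    have := hF (MvPolynomial.mem_support_iff.1 hs)
    simpa [Finsupp.weight_apply, Finsupp.sum] using this
  simp only [map_smul, smul_eq_mul, mul_pow, Finset.prod_mul_distrib,
    Finset.prod_pow_eq_pow_sum, hd]
  ring

theorem evalAt_rep {d : ℕ} {F : Poly K W} (hF : F.IsHomogeneous d) {x : W} (hx : x ≠ 0) :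
    ∃ u : K, u ≠ 0 ∧ evalAt (Projectivization.mk K x hx).rep F = u ^ d * evalAt x F := by
  obtain ⟨u, hu⟩ := Projectivization.exists_smul_eq_mk_rep K x hx
  exact ⟨u, u.ne_zero, by rw [← hu, Units.smul_def, evalAt_smul hF]⟩

theorem isOpen_evalAt_ne_zero {d : ℕ} {F : Poly K W} (hF : F.IsHomogeneous d) :
    IsOpen[(projectiveSpace K W).topology] {x | evalAt x.rep F ≠ 0} :=
  TopologicalSpace.isOpen_generateFrom_of_mem ⟨d, F, hF, rfl⟩

open MvPolynomial in
/-- A map to projective space given by a vector with polynomial coordinates is a morphism. -/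
theorem isMorphism_mk {ι : Type*} {v : (ι → K) → W} (hv : ∀ x, v x ≠ 0)
    (hpoly : ∀ φ : Module.Dual K W, ∃ P : MvPolynomial ι K, ∀ x, φ (v x) = eval x P) :
    IsMorphism (affineSpace K ι) (projectiveSpace K W)
      fun x => Projectivization.mk K (v x) (hv x) := by
  choose P hP using hpoly
  have key : ∀ (x : ι → K) (F : Poly K W), evalAt (v x) F = eval x (bind₁ P F) := by
    intro x F
    rw [evalAt, eval_bind₁]
    simp only [hP]
  refine ⟨continuous_generateFrom_iff.2 ?_, fun U _ f hf x hx => ?_⟩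
  · rintro _ ⟨d, F, hF, rfl⟩
    convert isOpen_ne_zero (bind₁ P F) using 1
    ext x
    obtain ⟨u, hu, h⟩ := evalAt_rep hF (hv x)
    change _ ≠ 0 ↔ _ ≠ 0
    rw [h, key]
    simp [hu]
  · obtain ⟨d, F, G, hF, hG, hG0, h⟩ := hf _ hx
    refine ⟨bind₁ P F, bind₁ P G, ?_, fun y hy hy0 => ?_⟩
    · obtain ⟨u, hu, hG'⟩ := evalAt_rep hG (hv x)
      rw [hG', key] at hG0
      exact right_ne_zero_of_mul hG0
    · obtain ⟨u, hu⟩ := Projectivization.exists_smul_eq_mk_rep K (v y) (hv y)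
      have hmk : ∀ H : Poly K W, H.IsHomogeneous d →
          evalAt (Projectivization.mk K (v y) (hv y)).rep H = (u : K) ^ d * eval y (bind₁ P H) := by
        intro H hH
        rw [← hu, Units.smul_def, evalAt_smul hH, key]
      have hu0 : (u : K) ^ d ≠ 0 := pow_ne_zero _ u.ne_zero
      have h' := h _ hy (by rw [hmk G hG]; exact mul_ne_zero hu0 hy0)
      rw [hmk F hF, hmk G hG, mul_div_mul_left _ _ hu0] at h'
      exact h'

open MvPolynomial in
/-- Homogenization: `L ^ d * Q(L_i / L)` is a homogeneous polynomial for all large `d`. -/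
theorem exists_homogenization {ι : Type*} (L : Module.Dual K W) (Li : ι → Module.Dual K W)
    (Q : MvPolynomial ι K) : ∃ N : ℕ, ∀ d ≥ N, ∃ F : Poly K W, F.IsHomogeneous d ∧
      ∀ w : W, L w ≠ 0 → evalAt w F = L w ^ d * eval (fun i => Li i w / L w) Q := by
  induction Q using MvPolynomial.induction_on with
  | C a =>
    refine ⟨0, fun d _ => ⟨C a * X L ^ d, ?_, fun w _ => ?_⟩⟩
    · simpa using (isHomogeneous_C _ a).mul ((isHomogeneous_X K L).pow d)
    · simp [evalAt, mul_comm]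
  | add P Q hP hQ =>
    obtain ⟨N, hN⟩ := hP
    obtain ⟨N', hN'⟩ := hQ
    refine ⟨max N N', fun d hd => ?_⟩
    obtain ⟨F, hF, hFw⟩ := hN d (le_of_max_le_left hd)
    obtain ⟨G, hG, hGw⟩ := hN' d (le_of_max_le_right hd)
    refine ⟨F + G, hF.add hG, fun w hw => ?_⟩
    rw [map_add, mul_add, ← hFw w hw, ← hGw w hw]
    exact map_add _ _ _
  | mul_X P i hP =>
    obtain ⟨N, hN⟩ := hP
    refine ⟨N + 1, fun d hd => ?_⟩
    obtain ⟨F, hF, hFw⟩ := hN (d - 1) (by omega)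
    obtain ⟨d, rfl⟩ : ∃ d', d = d' + 1 := ⟨d - 1, by omega⟩
    refine ⟨F * X (Li i), hF.mul (isHomogeneous_X K _), fun w hw => ?_⟩
    have h : evalAt w (F * X (Li i)) = evalAt w F * Li i w := by simp [evalAt]
    rw [h, hFw w hw, map_mul, eval_X]
    rw [Nat.add_sub_cancel, pow_succ]
    field_simp

open MvPolynomial in
/-- A map to affine space whose coordinates are quotients `L_i / L` of linear forms on projective
space is a morphism. -/
theorem isMorphism_div {ι Y : Type*} {T : FunSpace K Y} (hT : IsLocal T) {μ : Y → ℙ K W}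
    (hμ : IsMorphism T (projectiveSpace K W) μ) (L : Module.Dual K W) (Li : ι → Module.Dual K W)
    (hL : ∀ y, L (μ y).rep ≠ 0) :
    IsMorphism T (affineSpace K ι) fun y i => Li i (μ y).rep / L (μ y).rep := by
  refine ⟨continuous_generateFrom_iff.2 ?_, fun U _ f hf => hT _ _ fun y hy => ?_⟩
  · rintro _ ⟨Q, rfl⟩
    obtain ⟨N, hN⟩ := exists_homogenization L Li Q
    obtain ⟨F, hF, hFw⟩ := hN N le_rfl
    convert continuous_def.1 hμ.1 _ (isOpen_evalAt_ne_zero hF) using 1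
    ext y
    change _ ≠ 0 ↔ evalAt (μ y).rep F ≠ 0
    rw [hFw _ (hL y)]
    simp [hL y]
  · obtain ⟨P, Q, hQ, h⟩ := hf _ hy
    obtain ⟨N, hN⟩ := exists_homogenization L Li P
    obtain ⟨N', hN'⟩ := exists_homogenization L Li Q
    obtain ⟨F, hF, hFw⟩ := hN (max N N') (le_max_left _ _)
    obtain ⟨G, hG, hGw⟩ := hN' (max N N') (le_max_right _ _)
    have hG0 := isOpen_evalAt_ne_zero hG
    refine ⟨μ ⁻¹' {x | evalAt x.rep G ≠ 0}, (fun x => evalAt x.rep F / evalAt x.rep G) ∘ μ,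
      continuous_def.1 hμ.1 _ hG0, hμ.2 _ hG0 _ ?_, ?_, fun z hz hz0 => ?_⟩
    · exact fun x hx => ⟨_, F, G, hF, hG, hx, fun _ _ _ => rfl⟩
    · change evalAt (μ y).rep G ≠ 0
      rw [hGw _ (hL y)]
      exact mul_ne_zero (pow_ne_zero _ (hL y)) hQ
    · change evalAt (μ z).rep G ≠ 0 at hz0
      rw [hGw _ (hL z)] at hz0
      change _ = evalAt (μ z).rep F / evalAt (μ z).rep G
      rw [hFw _ (hL z), hGw _ (hL z), mul_div_mul_left _ _ (pow_ne_zero _ (hL z))]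
      exact h _ hz (right_ne_zero_of_mul hz0)

end Projective

end Var

/-! ### Affine charts of the Grassmannian -/

namespace Var

section Chart

open Module MvPolynomial

variable {K : Type u} [Field K] {M : Type v} [AddCommGroup M] [Module K M] {m : ℕ}

theorem exists_basis_sum {J : Type*} {a : J → M} (ha : LinearIndependent K a) {C : Submodule K M}
    (hC : IsCompl (Submodule.span K (Set.range a)) C) (c : Basis (Fin m) K C) :
    ∃ B : Basis (J ⊕ Fin m) K M, (∀ i, B (Sum.inl i) = a i) ∧ ∀ j, B (Sum.inr j) = c j := by
  refine ⟨((Basis.span ha).prod c).map (Submodule.prodEquivOfIsCompl _ _ hC), fun i => ?_,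
    fun j => ?_⟩
  · simp [Basis.span_apply]
  · simp

/-- Any basis of `C` may be used to compute its Plücker coordinates. -/
theorem exists_rep_plucker (C : Gr K M m) (b : Basis (Fin m) K C.1) :
    ∃ u : K, u ≠ 0 ∧ (plucker C).rep = u • exteriorPower.ιMulti K m fun i => (b i : M) := by
  have := C.2.1
  obtain ⟨u, hu⟩ := Projectivization.exists_smul_eq_mk_rep K (pluckerVector C)
    (pluckerVector_ne_zero C)
  let b' := Module.finBasisOfFinrankEq K C.1 C.2.2
  have hdet : pluckerVector C = b.det b' • exteriorPower.ιMulti K m fun i => (b i : M) := by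
    rw [← sub_eq_zero, ← Module.forall_dual_apply_eq_zero_iff K]
    intro φ
    have h := congrArg (fun g => g b') (AlternatingMap.eq_smul_basis_det b
      ((φ.compAlternatingMap (exteriorPower.ιMulti K m)).compLinearMap C.1.subtype))
    rw [map_sub, map_smul, sub_eq_zero, smul_eq_mul, mul_comm]
    exact h
  refine ⟨u * b.det b', mul_ne_zero u.ne_zero ?_, ?_⟩
  · intro h0
    rw [h0, zero_smul] at hdet
    exact pluckerVector_ne_zero C hdet
  · rw [mul_smul, ← hdet]
    exact hu.symm

variable {J : Type*} (B : Basis (J ⊕ Fin m) K M)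

/-- The linear form `v_1 ∧ ⋯ ∧ v_m ↦ det (σ_j-th coordinate of v_t)` on the exterior power. -/
noncomputable def detForm (σ : Fin m → J ⊕ Fin m) : Module.Dual K (⋀[K]^m M) :=
  exteriorPower.alternatingMapLinearEquiv
    (Matrix.detRowAlternating.compLinearMap (LinearMap.pi fun j => B.coord (σ j)))

theorem detForm_ιMulti (σ : Fin m → J ⊕ Fin m) (v : Fin m → M) :
    detForm B σ (exteriorPower.ιMulti K m v) = Matrix.det fun t j => B.coord (σ j) (v t) := by
  rw [detForm, exteriorPower.alternatingMapLinearEquiv_apply_ιMulti]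
  rfl

/-- The coordinates of a point in the chart: quotients of Plücker coordinates. -/
noncomputable def chartCoord (C : Gr K M m) : J × Fin m → K := fun x =>
  detForm B (Function.update Sum.inr x.2 (Sum.inl x.1)) (plucker C).rep
    / detForm B Sum.inr (plucker C).rep

/-- The domain of the chart: the subspaces with nonzero projection determinant. -/
def chartDomain : Set (Gr K M m) := {C | detForm B Sum.inr (plucker C).rep ≠ 0}

theorem isMorphism_chartCoord {Z : Set (Gr K M m)} (hZ : Z ⊆ chartDomain B) :
    IsMorphism (restrict (grassmannian K M m) Z) (affineSpace K (J × Fin m))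
      fun C => chartCoord B C.1 :=
  isMorphism_div (isLocal_induced (restricts_induced _ _) _)
    ((isMorphism_induced _ plucker).comp (isMorphism_induced _ _))
    (detForm B Sum.inr) _ fun C => hZ C.2

theorem isOpen_chartDomain : IsOpen[(grassmannian K M m).topology] (chartDomain B) := by
  have h := isOpen_evalAt_ne_zero (isHomogeneous_X K (detForm B Sum.inr))
  have h' := continuous_def.1 (isMorphism_induced _ plucker).1 _ h
  have heq : chartDomain B = plucker ⁻¹' {x | evalAt x.rep (X (detForm B Sum.inr)) ≠ 0} := by
    refine Set.ext fun C => ?_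
    change _ ≠ 0 ↔ evalAt (plucker C).rep _ ≠ 0
    simp [evalAt]
  rw [heq]
  exact h'

variable [Fintype J]

/-- The vectors `c_j + ∑ f_ij a_i`, where the `a_i` and `c_j` form a basis of `M`. They span the
graph of the linear map from the span of the `c_j` to the span of the `a_i` with matrix `f`. -/
noncomputable def graphVec (f : J × Fin m → K) (j : Fin m) : M :=
  B (Sum.inr j) + ∑ i, f (i, j) • B (Sum.inl i)

open Classical in
theorem coord_inr_graphVec (f : J × Fin m → K) (j j' : Fin m) :
    B.coord (Sum.inr j') (graphVec B f j) = if j = j' then 1 else 0 := by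
  simp [graphVec, Finsupp.single_apply]

theorem coord_inl_graphVec (f : J × Fin m → K) (j : Fin m) (i : J) :
    B.coord (Sum.inl i) (graphVec B f j) = f (i, j) := by
  classical
  simp [graphVec, Finsupp.single_apply]

theorem linearIndependent_graphVec (f : J × Fin m → K) : LinearIndependent K (graphVec B f) := by
  rw [Fintype.linearIndependent_iff]
  intro g hg j
  have := congrArg (B.coord (Sum.inr j)) hg
  simpa only [map_sum, map_smul, coord_inr_graphVec, smul_eq_mul, mul_ite, mul_one, mul_zero,
    Finset.sum_ite_eq', Finset.mem_univ, if_true, map_zero] using this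

/-- The point of the Grassmannian spanned by the vectors `c_j + ∑ f_ij a_i`. -/
def chart (f : J × Fin m → K) : Gr K M m :=
  ⟨Submodule.span K (Set.range (graphVec B f)),
    FiniteDimensional.span_of_finite K (Set.finite_range _), by
    rw [finrank_span_eq_card (linearIndependent_graphVec B f), Fintype.card_fin]⟩

theorem coord_inl_of_mem_chart {f : J × Fin m → K} {y : M} (hy : y ∈ (chart B f).1) (i : J) :
    B.coord (Sum.inl i) y = ∑ j, B.coord (Sum.inr j) y * f (i, j) := by
  obtain ⟨c, rfl⟩ := (Submodule.mem_span_range_iff_exists_fun K).1 hy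
  simp only [map_sum, map_smul, coord_inr_graphVec, coord_inl_graphVec, smul_eq_mul, mul_ite,
    mul_one, mul_zero, Finset.sum_ite_eq', Finset.mem_univ, if_true]

/-- The matrix of the `c_j`-coordinates of the vectors `c_t + ∑ f_it a_i` is the identity. -/
theorem detForm_inr_graphVec (f : J × Fin m → K) :
    detForm B Sum.inr (exteriorPower.ιMulti K m (graphVec B f)) = 1 := by
  rw [detForm_ιMulti]
  have h : (fun t j => B.coord (Sum.inr j) (graphVec B f t)) = (1 : Matrix (Fin m) (Fin m) K) := by
    ext t j
    rw [coord_inr_graphVec, Matrix.one_apply]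
  rw [h, Matrix.det_one]

/-- If the `j`-th column of the identity matrix is replaced by the `a_i`-coordinates of the vectors
`c_t + ∑ f_it a_i`, then the determinant is `f_ij`. -/
theorem detForm_update_graphVec (f : J × Fin m → K) (i : J) (j : Fin m) :
    detForm B (Function.update Sum.inr j (Sum.inl i))
      (exteriorPower.ιMulti K m (graphVec B f)) = f (i, j) := by
  rw [detForm_ιMulti]
  have h : (fun t j' => B.coord (Function.update Sum.inr j (Sum.inl i) j') (graphVec B f t))
      = (1 : Matrix (Fin m) (Fin m) K).updateCol j fun t => f (i, t) := by
    ext t j'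
    rcases eq_or_ne j' j with rfl | h
    · rw [Function.update_self, coord_inl_graphVec, Matrix.updateCol_self]
    · rw [Function.update_of_ne h, coord_inr_graphVec, Matrix.updateCol_ne h, Matrix.one_apply]
  have h2 := Matrix.cramer_apply (1 : Matrix (Fin m) (Fin m) K) (fun t => f (i, t)) j
  rw [Matrix.cramer_one] at h2
  rw [h]
  exact h2.symm

theorem exists_rep_plucker_chart (f : J × Fin m → K) : ∃ u : K, u ≠ 0 ∧
    (plucker (chart B f)).rep = u • exteriorPower.ιMulti K m (graphVec B f) := by
  obtain ⟨u, hu, h⟩ := exists_rep_plucker (chart B f)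
    (Basis.span (linearIndependent_graphVec B f))
  refine ⟨u, hu, h.trans ?_⟩
  congr 2
  funext i
  exact congrArg Subtype.val (Basis.span_apply (linearIndependent_graphVec B f) i)

theorem chartCoord_chart (f : J × Fin m → K) : chartCoord B (chart B f) = f := by
  obtain ⟨u, hu, h⟩ := exists_rep_plucker_chart B f
  funext x
  rw [chartCoord, h, map_smul, map_smul, detForm_inr_graphVec, detForm_update_graphVec,
    smul_eq_mul, smul_eq_mul, mul_one, mul_div_cancel_left₀ _ hu]

theorem chart_mem_chartDomain (f : J × Fin m → K) : chart B f ∈ chartDomain B := by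
  obtain ⟨u, hu, h⟩ := exists_rep_plucker_chart B f
  change _ ≠ 0
  rw [h, map_smul, detForm_inr_graphVec, smul_eq_mul, mul_one]
  exact hu

theorem chart_eq_of_graphVec_mem {f : J × Fin m → K} {C : Gr K M m}
    (h : ∀ j, graphVec B f j ∈ C.1) : chart B f = C := by
  have := C.2.1
  refine Subtype.ext (Submodule.eq_of_le_of_finrank_eq ?_ ?_)
  · exact Submodule.span_le.2 (Set.range_subset_iff.2 h)
  · exact (chart B f).2.2.trans C.2.2.symm

theorem exists_graphVec_mem {C : Submodule K M}
    (h : IsCompl (Submodule.span K (Set.range fun i => B (Sum.inl i))) C) :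
    ∃ f : J × Fin m → K, ∀ j, graphVec B f j ∈ C := by
  have hdec : ∀ j, ∃ f : J → K, B (Sum.inr j) + ∑ i, f i • B (Sum.inl i) ∈ C := by
    intro j
    obtain ⟨a, ha, c, hc, hac⟩ := Submodule.mem_sup.1
      ((codisjoint_iff.1 h.2).symm ▸ Submodule.mem_top : B (Sum.inr j) ∈ _)
    obtain ⟨f, rfl⟩ := (Submodule.mem_span_range_iff_exists_fun K).1 ha
    refine ⟨fun i => -f i, ?_⟩
    rw [← hac]
    simpa using hc
  choose f hf using hdec
  exact ⟨fun x => f x.2 x.1, hf⟩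

/-- The domain of the chart consists of the complements of the span of the `a_i`. -/
theorem mem_chartDomain_iff_isCompl {C : Gr K M m} :
    C ∈ chartDomain B ↔ IsCompl (Submodule.span K (Set.range fun i => B (Sum.inl i))) C.1 := by
  classical
  have hfin := C.2.1
  have : Module.Finite K M := Module.Finite.of_basis B
  constructor
  · intro h
    let b := Module.finBasisOfFinrankEq K C.1 C.2.2
    obtain ⟨u, hu, hrep⟩ := exists_rep_plucker C b
    change _ ≠ 0 at h
    rw [hrep, map_smul, detForm_ιMulti] at h
    have hdet := right_ne_zero_of_mul h
    have hdis : Disjoint (Submodule.span K (Set.range fun i => B (Sum.inl i))) C.1 := by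
      rw [Submodule.disjoint_def]
      intro y hy hyC
      have h0 : ∀ j, B.coord (Sum.inr j) y = 0 := by
        intro j
        obtain ⟨c, rfl⟩ := (Submodule.mem_span_range_iff_exists_fun K).1 hy
        simp
      have hy' : y = ∑ t, b.repr ⟨y, hyC⟩ t • (b t : M) := by
        have := congrArg (C.1.subtype) (b.sum_repr ⟨y, hyC⟩)
        rw [map_sum] at this
        exact this.symm
      have hz := Matrix.eq_zero_of_vecMul_eq_zero hdet (v := b.repr ⟨y, hyC⟩) (by
        funext j
        rw [Pi.zero_apply, ← h0 j]
        conv_rhs => rw [hy']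
        simp [Matrix.vecMul, dotProduct])
      rw [hy']
      exact Finset.sum_eq_zero fun t _ => by rw [hz]; simp
    refine ⟨hdis, codisjoint_iff.2 (Submodule.eq_top_of_disjoint _ _ ?_ hdis)⟩
    have h1 := finrank_span_eq_card (B.linearIndependent.comp _ Sum.inl_injective)
    have h2 := Module.finrank_eq_card_basis B
    rw [Fintype.card_sum, Fintype.card_fin, ← h1] at h2
    exact (h2.trans (congrArg _ C.2.2.symm)).le
  · intro h
    obtain ⟨f, hf⟩ := exists_graphVec_mem B h
    rw [← chart_eq_of_graphVec_mem B hf]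
    exact chart_mem_chartDomain B _

theorem chart_chartCoord {C : Gr K M m} (hC : C ∈ chartDomain B) : chart B (chartCoord B C) = C := by
  have h := (mem_chartDomain_iff_isCompl B).1 hC
  obtain ⟨f, hf⟩ := exists_graphVec_mem B h
  rw [← chart_eq_of_graphVec_mem B hf, chartCoord_chart]

theorem exists_poly_graphVec (φ : Module.Dual K M) (j : Fin m) :
    ∃ P : MvPolynomial (J × Fin m) K, ∀ f, φ (graphVec B f j) = eval f P := by
  refine ⟨C (φ (B (Sum.inr j))) + ∑ i, X (i, j) * C (φ (B (Sum.inl i))), fun f => ?_⟩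
  simp [graphVec]

/-- All Plücker coordinates are polynomials in the chart coordinates. -/
theorem exists_poly_ιMulti_graphVec (φ : Module.Dual K (⋀[K]^m M)) :
    ∃ P : MvPolynomial (J × Fin m) K,
      ∀ f, φ (exteriorPower.ιMulti K m (graphVec B f)) = eval f P := by
  classical
  choose P hP using fun (b : J ⊕ Fin m) (j : Fin m) => exists_poly_graphVec B (B.coord b) j
  let g : M [⋀^Fin m]→ₗ[K] K := φ.compAlternatingMap (exteriorPower.ιMulti K m)
  refine ⟨∑ r : Fin m → J ⊕ Fin m, (∏ t, P (r t) t) * C (g fun t => B (r t)), fun f => ?_⟩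
  have h : graphVec B f = fun t => ∑ b, eval f (P b t) • B b := by
    funext t
    conv_lhs => rw [← B.sum_repr (graphVec B f t)]
    exact Finset.sum_congr rfl fun b _ => by rw [← hP]; rfl
  change g.toMultilinearMap (graphVec B f) = _
  rw [h, MultilinearMap.map_sum]
  simp [MultilinearMap.map_smul_univ]

theorem isMorphism_chart :
    IsMorphism (affineSpace K (J × Fin m)) (grassmannian K M m) (chart B) := by
  refine IsMorphism.codInduced isLocal_affineSpace ?_
  have hne : ∀ f : J × Fin m → K, exteriorPower.ιMulti K m (graphVec B f) ≠ 0 := by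
    intro f h
    have := detForm_inr_graphVec B f
    rw [h, map_zero] at this
    exact zero_ne_one this
  have := isMorphism_mk hne (exists_poly_ιMulti_graphVec B)
  convert this using 1
  funext f
  obtain ⟨u, hu, h⟩ := exists_rep_plucker_chart B f
  rw [Function.comp_apply, ← Projectivization.mk_rep (plucker (chart B f)),
    Projectivization.mk_eq_mk_iff']
  exact ⟨u, h.symm⟩

/-- The chart as a bijection from affine space onto its domain. -/
noncomputable def chartEquiv : (J × Fin m → K) ≃ chartDomain B where
  toFun f := ⟨chart B f, chart_mem_chartDomain B f⟩
  invFun C := chartCoord B C.1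
  left_inv := chartCoord_chart B
  right_inv C := Subtype.ext (chart_chartCoord B C.2)

theorem isPrincipalAffine_chartDomain : IsPrincipalAffine (chartDomain B) := by
  refine ⟨⟨1, X (detForm B Sum.inr), one_pos, isHomogeneous_X K _, Set.ext fun C => ?_⟩, ?_⟩
  · have := C.2.1
    obtain ⟨u, hu, h⟩ := exists_rep_plucker C (Module.finBasisOfFinrankEq K C.1 C.2.2)
    change _ ≠ 0 ↔ evalAt (pluckerVector C) _ ≠ 0
    rw [h, map_smul]
    simp [evalAt, hu, pluckerVector]
  · have hloc : IsLocal (restrict (grassmannian K M m) (chartDomain B)) :=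
      isLocal_induced (restricts_induced _ _) _
    refine isAffine_of_isIso (Z := (Set.univ : Set (J × Fin m → K)))
      (@isClosed_univ _ (_)) (φ := (chartEquiv B).symm.trans (Equiv.Set.univ _).symm) ⟨?_, ?_⟩
    · exact IsMorphism.codInduced hloc (isMorphism_chartCoord B subset_rfl)
    · exact IsMorphism.codInduced (isLocal_induced restricts_affineSpace _)
        ((isMorphism_chart B).comp (isMorphism_induced _ _))

/-- The subspaces which are stable under an endomorphism form a closed set: in the chart around an
unstable subspace, stability is given by polynomial equations. -/
theorem isClosed_stable [Module.Finite K M] (T : M →ₗ[K] M) :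
    IsClosed[(grassmannian K M m).topology] {C | ∀ c ∈ C.1, T c ∈ C.1} := by
  refine @IsClosed.mk _ (_) _ ?_
  let : TopologicalSpace (Gr K M m) := (grassmannian K M m).topology
  refine isOpen_iff_forall_mem_open.2 fun C₀ hC₀ => ?_
  have := C₀.2.1
  obtain ⟨A, hA⟩ := Submodule.exists_isCompl C₀.1
  let a := Module.finBasis K A
  let c := Module.finBasisOfFinrankEq K C₀.1 C₀.2.2
  have ha : LinearIndependent K fun i => (a i : M) :=
    a.linearIndependent.map' A.subtype (Submodule.ker_subtype _)
  have hspan : Submodule.span K (Set.range fun i => (a i : M)) = A := by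
    have := congrArg (Submodule.map A.subtype) a.span_eq
    rw [Submodule.map_span, ← Set.range_comp, Submodule.map_top, Submodule.range_subtype] at this
    exact this
  obtain ⟨B, hBa, hBc⟩ := exists_basis_sum ha (hspan.symm ▸ hA.symm) c
  have hC₀' : chart B 0 = C₀ :=
    chart_eq_of_graphVec_mem B fun j => by simp [graphVec, hBc]
  -- the equations for `T (c_j + ∑ f_ij a_i)` to lie in the graph of `f`
  choose P hP using fun b j => exists_poly_graphVec B ((B.coord b).comp T) j
  let Q : Fin (finrank K A) → Fin m → MvPolynomial (Fin (finrank K A) × Fin m) K := fun i j =>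
    P (Sum.inl i) j - ∑ j', P (Sum.inr j') j * X (i, j')
  have hQ : ∀ f i j, eval f (Q i j) = B.coord (Sum.inl i) (T (graphVec B f j))
      - ∑ j', B.coord (Sum.inr j') (T (graphVec B f j)) * f (i, j') := by
    intro f i j
    simp only [Q, map_sub, map_sum, map_mul, eval_X, ← hP]
    rfl
  obtain ⟨i, j, hij⟩ : ∃ i j, eval 0 (Q i j) ≠ 0 := by
    by_contra! h
    apply hC₀
    rw [← hC₀']
    intro y hy
    refine Submodule.span_induction (p := fun y _ => T y ∈ (chart B 0).1) ?_ (by simp)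
      (fun x y _ _ hx hy => by rw [map_add]; exact add_mem hx hy)
      (fun r x _ hx => by rw [map_smul]; exact Submodule.smul_mem _ r hx) hy
    rintro _ ⟨j, rfl⟩
    have h0 : ∀ i, B.coord (Sum.inl i) (T (graphVec B 0 j)) = 0 := fun i => by
      have := h i j
      rw [hQ] at this
      simpa using this
    rw [← B.sum_repr (T (graphVec B 0 j)), Fintype.sum_sum_type]
    refine add_mem (sum_mem fun i _ => ?_) (sum_mem fun j' _ => Submodule.smul_mem _ _ ?_)
    · rw [← Basis.coord_apply, h0, zero_smul]
      exact zero_mem _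
    · exact Submodule.subset_span ⟨j', by simp [graphVec]⟩
  have hcont := continuous_def.1 (isMorphism_chartCoord B subset_rfl).1 _ (isOpen_ne_zero (Q i j))
  obtain ⟨O, hO, hOeq⟩ := hcont
  refine ⟨O ∩ chartDomain B, fun C hC hstab => ?_,
    @IsOpen.inter _ (_) _ _ hO (isOpen_chartDomain B), ?_⟩
  · have h1 : (⟨C, hC.2⟩ : chartDomain B) ∈ Subtype.val ⁻¹' O := hC.1
    rw [hOeq] at h1
    apply h1
    rw [hQ, sub_eq_zero]
    refine coord_inl_of_mem_chart B (f := chartCoord B C) ?_ i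
    rw [chart_chartCoord B hC.2]
    apply hstab
    have : graphVec B (chartCoord B C) j ∈ (chart B (chartCoord B C)).1 :=
      Submodule.subset_span ⟨j, rfl⟩
    rwa [chart_chartCoord B hC.2] at this
  · have hmem : C₀ ∈ chartDomain B := hC₀' ▸ chart_mem_chartDomain B 0
    refine ⟨?_, hmem⟩
    have h1 : (⟨C₀, hmem⟩ : chartDomain B) ∈ Subtype.val ⁻¹' O := by
      rw [hOeq]
      change eval (chartCoord B C₀) (Q i j) ≠ 0
      rw [← hC₀', chartCoord_chart]
      exact hij
    exact h1

end Chart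

end Var

/-! ### The variety of uniserial modules with mast `p` -/

namespace BoundQuiver

open Var MvPolynomial

section Main

variable {K : Type u} [Field K] {V : Type v} [Quiver.{w} V] [Fintype V]
  {I : Ideal (PathAlgebra K V)} [I.IsTwoSided]
  {l : ℕ} {e : Fin (l + 1) → V} {γ : ∀ i : Fin l, e i.castSucc ⟶ e i.succ}

theorem gUni_eq (B : Module.Basis (Fin (l + 1) ⊕ Fin (codim I γ)) K (Proj I (e 0)))
    (hB : ∀ i, B (Sum.inl i) = elt I (sub γ i)) : gUni I γ = chartDomain B ∩ grLam I γ := by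
  have hA : Submodule.span K (Set.range fun i => B (Sum.inl i)) = spanA I γ := by
    simp only [hB, spanA]
  refine Set.ext fun C => ⟨fun h => ⟨?_, h.1⟩, fun h => ⟨h.2, ?_⟩⟩
  · rw [mem_chartDomain_iff_isCompl, hA]
    exact h.2
  · rw [← hA]
    exact (mem_chartDomain_iff_isCompl B).1 h.1

/-- If `ψ_p(k)` lies in the chart, then `k` is a polynomial function of its chart coordinates. -/
theorem coord_eq_of_chart_eq (hI : IsRelationIdeal I)
    (hp : (PathAlgebra.single (.of (full γ)) : PathAlgebra K V) ∉ I)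
    {B : Module.Basis (Fin (l + 1) ⊕ Fin (codim I γ)) K (Proj I (e 0))}
    (hB : ∀ i, B (Sum.inl i) = elt I (sub γ i)) {k : Coord I γ → K}
    (hk : IsCompl (spanA I γ) ((psi I γ k).restrictScalars K))
    {f : Fin (l + 1) × Fin (codim I γ) → K}
    (hf : (chart B f).1 = (psi I γ k).restrictScalars K) (d : Detour I γ) (i : d.Idx) :
    k ⟨d, i⟩ = B.coord (Sum.inl i.1) (elt I d.path)
      - ∑ j, B.coord (Sum.inr j) (elt I d.path) * f (i.1, j) := by
  refine coord_eq_of_mem_psi hI hp hk d (a := fun i => B.coord (Sum.inl i) (elt I d.path)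
    - ∑ j, B.coord (Sum.inr j) (elt I d.path) * f (i, j)) ?_ i
  have h1 : ∑ j, B.coord (Sum.inr j) (elt I d.path) • graphVec B f j
      ∈ (psi I γ k).restrictScalars K := by
    rw [← hf]
    exact sum_mem fun j _ => Submodule.smul_mem _ _ (Submodule.subset_span ⟨j, rfl⟩)
  have h2 : ∑ i, B.coord (Sum.inl i) (elt I d.path) • elt I (sub γ i)
      + ∑ j, B.coord (Sum.inr j) (elt I d.path) • B (Sum.inr j) = elt I d.path := by
    have h := B.sum_repr (elt I d.path)
    rw [Fintype.sum_sum_type] at h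
    simp only [hB] at h
    exact h
  have h3 : ∑ j, B.coord (Sum.inr j) (elt I d.path) • graphVec B f j
      = ∑ j, B.coord (Sum.inr j) (elt I d.path) • B (Sum.inr j)
        + ∑ i, (∑ j, B.coord (Sum.inr j) (elt I d.path) * f (i, j)) • elt I (sub γ i) := by
    simp only [graphVec, smul_add, Finset.sum_add_distrib, Finset.smul_sum, Finset.sum_smul,
      smul_smul, hB]
    rw [Finset.sum_comm (γ := Fin (l + 1))]
  have aux : ∀ x y z t : Proj I (e 0), x + z = t → t - (x - y) = z + y := by
    rintro x y z _ rfl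
    abel
  simp only [sub_smul, Finset.sum_sub_distrib]
  rw [aux _ _ _ _ h2, ← h3]
  exact h1

variable [∀ a b : V, Finite (a ⟶ b)]

instance : Finite (Detour I γ) := by
  refine Finite.of_injective
    (β := Σ (m : Fin (l + 1)) (b : V), (e m ⟶ b)) (fun d => ⟨d.m, d.b, d.α⟩) ?_
  rintro ⟨m, b, α, h1, h2, h3⟩ ⟨m', b', α', h1', h2', h3'⟩ h
  simp only [Sigma.mk.injEq] at h
  obtain ⟨rfl, h⟩ := h
  simp only [heq_eq_eq, Sigma.mk.injEq] at h
  obtain ⟨rfl, h⟩ := h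
  obtain rfl := eq_of_heq h
  rfl

theorem isClosed_grLam (hI : IsRelationIdeal I) :
    IsClosed[(grP I γ).topology] (grLam I γ) := by
  have := finite_proj hI (e 0)
  have h : grLam I γ = ⋂ a : Alg I,
      {C | ∀ c ∈ C.1, (Algebra.lsmul K K (Proj I (e 0)) a) c ∈ C.1} := by
    ext C
    rw [Set.mem_iInter]
    rfl
  rw [h]
  exact @isClosed_iInter _ _ (_) _ fun a => isClosed_stable _

/-- A submodule complementing `A_p`, as a point of `G-Uni(p)`. -/
noncomputable def gUniMk (hI : IsRelationIdeal I) (C : Submodule (Alg I) (Proj I (e 0)))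
    (hC : IsCompl (spanA I γ) (C.restrictScalars K)) : gUni I γ :=
  haveI := finite_proj hI (e 0)
  ⟨⟨C.restrictScalars K, inferInstance, by
    have := Submodule.finrank_add_eq_of_isCompl hC
    rw [codim]
    omega⟩, fun a c hc => C.smul_mem a hc, hC⟩

/-- The map `ψ_p` is a bijection from `V_p` onto `G-Uni(p)`. -/
theorem exists_psiEquiv (hI : IsRelationIdeal I)
    (hp : (PathAlgebra.single (.of (full γ)) : PathAlgebra K V) ∉ I) :
    ∃ Ψ : uniVar I γ ≃ gUni I γ, ∀ k, (Ψ k).1.1 = (psi I γ k.1).restrictScalars K := by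
  refine ⟨Equiv.ofBijective (fun k => gUniMk hI (psi I γ k.1) (isCompl_psi hI k.2)) ⟨?_, ?_⟩,
    fun k => rfl⟩
  · intro k k' h
    have hpsi : psi I γ k.1 = psi I γ k'.1 :=
      Submodule.restrictScalars_injective K _ _ (congrArg (fun C => C.1.1) h)
    refine Subtype.ext (funext fun ⟨d, i⟩ => ?_)
    obtain ⟨a, ha, hmem⟩ := exists_coeff_mem_psi k'.1 d
    rw [← hpsi] at hmem
    rw [coord_eq_of_mem_psi hI hp (isCompl_psi hI k.2) d hmem i, ha]
  · intro C
    let C' : Submodule (Alg I) (Proj I (e 0)) :=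
      { C.1.1 with smul_mem' := fun a c hc => C.2.1 a c hc }
    obtain ⟨k, hk, hkC⟩ := exists_psi_eq hI hp (C := C') C.2.2
    refine ⟨⟨k, hk⟩, Subtype.ext (Subtype.ext ?_)⟩
    change (psi I γ k).restrictScalars K = C.1.1
    rw [hkC]
    rfl

/-- A basis of `Λ e` which extends the basis `p_0, …, p_l` of `A_p`. -/
theorem exists_basis (hI : IsRelationIdeal I)
    (hp : (PathAlgebra.single (.of (full γ)) : PathAlgebra K V) ∉ I) :
    ∃ B : Module.Basis (Fin (l + 1) ⊕ Fin (codim I γ)) K (Proj I (e 0)),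
      ∀ i, B (Sum.inl i) = elt I (sub γ i) := by
  have := finite_proj hI (e 0)
  obtain ⟨C, hC⟩ := Submodule.exists_isCompl (spanA I γ)
  have hdim : Module.finrank K C = codim I γ := by
    have := Submodule.finrank_add_eq_of_isCompl hC
    rw [codim]
    omega
  obtain ⟨B, hB, -⟩ := exists_basis_sum (linearIndependent_elt_sub γ hI hp) hC
    (Module.finBasisOfFinrankEq K C hdim)
  exact ⟨B, hB⟩

end Main

end BoundQuiver

theorem theoremA {K : Type u} [Field K] [IsAlgClosed K]
    {V : Type v} [Quiver.{w} V] [Fintype V] [∀ a b : V, Finite (a ⟶ b)]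
    (I : Ideal (PathAlgebra K V)) [I.IsTwoSided] (hI : BoundQuiver.IsRelationIdeal I)
    {l : ℕ} (e : Fin (l + 1) → V) (γ : ∀ i : Fin l, e i.castSucc ⟶ e i.succ)
    (hp : (PathAlgebra.single (.of (BoundQuiver.full γ)) : PathAlgebra K V) ∉ I) :
    -- the submodules form a closed subset of the Grassmannian
    IsClosed[(BoundQuiver.grP I γ).topology] (BoundQuiver.grLam I γ) ∧
    -- `G-Uni(p)` is an open subset of the variety of submodules, and it is affine
    IsOpen[(Var.restrict (BoundQuiver.grP I γ) (BoundQuiver.grLam I γ)).topology]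
      (Subtype.val ⁻¹' BoundQuiver.gUni I γ) ∧
    Var.IsAffine (Var.restrict (BoundQuiver.grP I γ) (BoundQuiver.gUni I γ)) ∧
    -- it is the intersection of a principal affine open set with the set of submodules
    (∃ D : Set (BoundQuiver.GrP I γ), Var.IsPrincipalAffine D ∧
      BoundQuiver.gUni I γ = D ∩ BoundQuiver.grLam I γ) ∧
    -- `V_p` is closed in affine space, and `ψ_p` is an isomorphism of varieties onto `G-Uni(p)`
    IsClosed[(Var.affineSpace K (BoundQuiver.Coord I γ)).topology] (BoundQuiver.uniVar I γ) ∧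
    ∃ Ψ : BoundQuiver.uniVar I γ ≃ BoundQuiver.gUni I γ,
      (∀ k, (Ψ k).1.1 = (BoundQuiver.psi I γ k.1).restrictScalars K) ∧
      Var.IsIso (Var.restrict (Var.affineSpace K (BoundQuiver.Coord I γ)) (BoundQuiver.uniVar I γ))
        (Var.restrict (BoundQuiver.grP I γ) (BoundQuiver.gUni I γ)) Ψ := by
  open BoundQuiver Var MvPolynomial in
  obtain ⟨B, hB⟩ := exists_basis hI hp
  have hD := gUni_eq B hB
  have hDsub : gUni I γ ⊆ chartDomain B := hD ▸ Set.inter_subset_left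
  have hgr := isClosed_grLam (γ := γ) hI
  obtain ⟨Ψ, hΨ⟩ := exists_psiEquiv hI hp
  -- `ψ_p(k)` is the point of the chart with coordinates `η(k)`
  choose F hF using fun z => exists_poly (I := I) γ z
  let η : (Coord I γ → K) → Fin (l + 1) × Fin (codim I γ) → K :=
    fun k x => eval k (-F (B (Sum.inr x.2)) x.1)
  have hη : IsMorphism (affineSpace K _) (affineSpace K _) η := isMorphism_polynomial _
  have hchart : ∀ k : uniVar I γ, chart B (η k.1) = (Ψ k).1 := by
    intro k
    refine chart_eq_of_graphVec_mem B fun j => ?_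
    rw [hΨ k]
    have := hF (B (Sum.inr j)) k.1
    simpa [graphVec, η, hB, sub_eq_add_neg] using this
  -- `k` is recovered from the chart coordinates `f` of `ψ_p(k)` by polynomials `θ(f)`
  let G : Coord I γ → MvPolynomial (Fin (l + 1) × Fin (codim I γ)) K := fun c =>
    C (B.coord (Sum.inl c.2.1) (elt I c.1.path))
      - ∑ j, C (B.coord (Sum.inr j) (elt I c.1.path)) * X (c.2.1, j)
  let θ : (Fin (l + 1) × Fin (codim I γ) → K) → Coord I γ → K := fun f c => eval f (G c)
  have hθ : IsMorphism (affineSpace K _) (affineSpace K _) θ := isMorphism_polynomial _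
  have hθΨ : ∀ (k : uniVar I γ) (f : Fin (l + 1) × Fin (codim I γ) → K),
      chart B f = (Ψ k).1 → θ f = k.1 := by
    intro k f hf
    funext ⟨d, i⟩
    rw [coord_eq_of_chart_eq hI hp hB (isCompl_psi hI k.2) (by rw [hf, hΨ k]) d i]
    simp [θ, G]
  have hΨsymm : ∀ C : gUni I γ, (Ψ.symm C).1 = θ (chartCoord B C.1) := by
    intro C
    refine (hθΨ (Ψ.symm C) _ ?_).symm
    rw [Equiv.apply_symm_apply, chart_chartCoord B (hDsub C.2)]
  have hiso : IsIso (restrict (affineSpace K (Coord I γ)) (uniVar I γ))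
      (restrict (grP I γ) (gUni I γ)) Ψ := by
    constructor
    · refine IsMorphism.codInduced (isLocal_induced restricts_affineSpace _) ?_
      convert (isMorphism_chart B).comp (hη.comp (isMorphism_induced _ Subtype.val)) using 1
      exact _root_.funext fun k => (hchart k).symm
    · refine IsMorphism.codInduced (isLocal_induced (restricts_induced _ _) _) ?_
      have hcomp : Subtype.val ∘ Ψ.symm = θ ∘ fun C : gUni I γ => chartCoord B C.1 :=
        _root_.funext hΨsymm
      rw [hcomp]
      exact hθ.comp (isMorphism_chartCoord B hDsub)
  have hVclosed : IsClosed[(affineSpace K (Coord I γ)).topology] (uniVar I γ) := by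
    -- `V_p` consists of the `k` with `η(k)` in the closed set of submodules and `θ(η(k)) = k`
    have h : uniVar I γ = ((chart B ∘ η) ⁻¹' grLam I γ)
        ∩ ⋂ c, {k | eval k (bind₁ (fun x : Fin (l + 1) × Fin (codim I γ) =>
          -F (B (Sum.inr x.2)) x.1) (G c) - X c) = 0} := by
      have hfix : ∀ k : Coord I γ → K,
          (k ∈ ⋂ c, {k | eval k (bind₁ (fun x : Fin (l + 1) × Fin (codim I γ) =>
            -F (B (Sum.inr x.2)) x.1) (G c) - X c) = 0}) ↔ θ (η k) = k := by
        intro k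
        rw [Set.mem_iInter, _root_.funext_iff]
        refine forall_congr' fun c => ?_
        change eval k _ = 0 ↔ _
        rw [map_sub, eval_bind₁, eval_X, sub_eq_zero]
      refine Set.ext fun k => ⟨fun hk => ⟨?_, (hfix k).2 (hθΨ ⟨k, hk⟩ _ (hchart ⟨k, hk⟩))⟩,
        fun hk => ?_⟩
      · change chart B (η k) ∈ grLam I γ
        rw [hchart ⟨k, hk⟩]
        exact (Ψ ⟨k, hk⟩).2.1
      · have hC : chart B (η k) ∈ gUni I γ := by
          rw [hD]
          exact ⟨chart_mem_chartDomain B _, hk.1⟩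
        have h1 := hθΨ (Ψ.symm ⟨_, hC⟩) (η k) (by rw [Equiv.apply_symm_apply])
        rw [(hfix k).1 hk.2] at h1
        rw [h1]
        exact (Ψ.symm ⟨_, hC⟩).2
    rw [h]
    refine @IsClosed.inter _ _ _ (_) ?_ (@isClosed_iInter _ _ (_) _ fun c => isClosed_eq_zero _)
    refine @IsClosed.mk _ (_) _ ?_
    exact continuous_def.1 ((isMorphism_chart B).comp hη).1 _ (@IsClosed.isOpen_compl _ _ (_) hgr)
  have hDopen := isOpen_chartDomain B
  refine ⟨hgr, ⟨chartDomain B, hDopen, ?_⟩, isAffine_of_isIso hVclosed hiso.symm,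
    ⟨chartDomain B, isPrincipalAffine_chartDomain B, hD⟩, hVclosed, Ψ, hΨ, hiso⟩
  refine Set.ext fun C => ?_
  change C.1 ∈ chartDomain B ↔ C.1 ∈ gUni I γ
  rw [hD]
  exact ⟨fun h => ⟨h, C.2⟩, fun h => h.1⟩
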